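/- Let $a,b,\alpha,x_0>0$ and let $W$ be a nonnegative random variable with $P(W>x)=ax^{-\alpha}$ for all $x\ge x_0$. For each $n$, let $W_1,\dots,W_n$ be i.i.d. copies of $W$, and let $G(n,\alpha)$ be the random simple graph on the vertex set $\{1,\dots,n\}$ in which, conditionally given $W_1,\dots,W_n$, the pairs $i<j$ are joined by an edge independently, with probabilities $p_{ij}=1-\exp(-bW_iW_j/n)$. Let $\omega(G(n,\alpha))$ be its clique number, the largest number of vertices in a complete subgraph. All limits are as $n\to\infty$. An event holds whp if its probability tends to $1$; and $X_n=o_p(1)$ means that $P(|X_n|>\varepsilon)\to0$ for every $\varepsilon>0$. (i) If $0<\alpha<2$, then $\omega(G(n,\alpha))=(c+o_p(1))\,n^{1-\alpha/2}(\log n)^{-\alpha/2}$, where $c=a\,b^{\alpha/2}(1-\alpha/2)^{-\alpha/2}$. (ii) If $\alpha=2$, then $\omega(G(n,\alpha))=O_p(1)$; that is, for every $\varepsilon>0$ there is a constant $C_\varepsilon$ such that $P(\omega(G(n,\alpha))>C_\varepsilon)\le\varepsilon$ for every $n$. However, there is no fixed finite $C$ such that $\omega(G(n,\alpha))\le C$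 whp. (iii) If $\alpha>2$, then $\omega(G(n,\alpha))\in\{2,3\}$ whp. Moreover $E W^2<\infty$, and $$P(\omega(G(n,\alpha))=2)\to e^{-\frac16(bE W^2)^3},\qquad P(\omega(G(n,\alpha))=3)\to 1-e^{-\frac16(bE W^2)^3},$$ and both limits are positive. -/

import Mathlib

open MeasureTheory ProbabilityTheory Filter Topology

noncomputable section

namespace PoissonianGraph

/-- The unordered pairs of distinct vertices of `{0, …, n-1}`, each listed once as `(i, j)`
with `i < j`. -/
abbrev Pairs (n : ℕ) : Type := {e : Fin n × Fin n // e.1 < e.2}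

/-- The edge probability `1 - exp (-b x y / n)` for two vertices of weights `x` and `y`. It lies
in `[0, 1]` by itself when `b, x, y ≥ 0`; the projection to `[0, 1]` only serves to make it a
probability for every real argument. -/
def edgeProb (b : ℝ) (n : ℕ) (x y : ℝ) : unitInterval :=
  Set.projIcc (0 : ℝ) 1 zero_le_one (1 - Real.exp (-(b * (x * y) / n)))

/-- For nonnegative weights the projection in `edgeProb` does nothing. -/
theorem coe_edgeProb {b : ℝ} (hb : 0 ≤ b) (n : ℕ) {x y : ℝ} (hx : 0 ≤ x) (hy : 0 ≤ y) :
    (edgeProb b n x y : ℝ) = 1 - Real.exp (-(b * (x * y) / n)) := by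
  have h1 : Real.exp (-(b * (x * y) / n)) ≤ 1 := by
    rw [Real.exp_le_one_iff, neg_nonpos]
    positivity
  have h2 := Real.exp_pos (-(b * (x * y) / n))
  rw [edgeProb, Set.projIcc_of_mem zero_le_one ⟨by linarith, by linarith⟩]

theorem measurable_edgeProb (b : ℝ) (n : ℕ) (i j : Fin n) :
    Measurable fun w : Fin n → ℝ ↦ edgeProb b n (w i) (w j) := by
  unfold edgeProb
  exact continuous_projIcc.measurable.comp (by fun_prop)

/-- The conditional law of the edge indicators given the weights `w`: independent Bernoulli
variables, the one of the pair `(i, j)` having parameter `edgeProb b n (w i) (w j)`. -/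
def pairMeasure (b : ℝ) (n : ℕ) (w : Fin n → ℝ) : Measure (Pairs n → Bool) :=
  Measure.pi fun e : Pairs n ↦ bernoulliMeasure true false (edgeProb b n (w e.1.1) (w e.1.2))

theorem measurable_pairMeasure (b : ℝ) (n : ℕ) : Measurable (pairMeasure b n) := by
  refine Measure.measurable_of_measurable_coe _ fun s _ ↦ ?_
  have key : ∀ w, pairMeasure b n w s =
      ∑ x : Pairs n → Bool, s.indicator 1 x * ∏ e : Pairs n,
        bernoulliMeasure true false (edgeProb b n (w e.1.1) (w e.1.2)) {x e} := by
    intro w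
    rw [← lintegral_indicator_one (MeasurableSet.of_discrete (s := s)), lintegral_fintype]
    refine Finset.sum_congr rfl fun x _ ↦ ?_
    rw [pairMeasure, ← Set.univ_pi_singleton x, Measure.pi_pi]
  simp_rw [key]
  refine Finset.measurable_sum _ fun x _ ↦ Measurable.const_mul ?_ _
  refine Finset.measurable_prod _ fun e _ ↦ ?_
  have hp := measurable_edgeProb b n e.1.1 e.1.2
  simp only [bernoulliMeasure_def, Measure.add_apply, Measure.smul_apply]
  have h1 : Measurable unitInterval.toNNReal := unitInterval.toNNReal_continuous.measurable
  have h2 : Measurable unitInterval.symm := unitInterval.continuous_symm.measurable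
  have h3 := h1.comp hp
  have h4 := h1.comp (h2.comp hp)
  simp only [ENNReal.smul_def, smul_eq_mul]
  exact ((measurable_coe_nnreal_ennreal.comp h3).mul_const _).add
    ((measurable_coe_nnreal_ennreal.comp h4).mul_const _)

/-- `pairMeasure` as a Markov kernel from weight vectors to edge indicators. -/
def pairKernel (b : ℝ) (n : ℕ) : Kernel (Fin n → ℝ) (Pairs n → Bool) :=
  ⟨pairMeasure b n, measurable_pairMeasure b n⟩

instance (b : ℝ) (n : ℕ) : IsMarkovKernel (pairKernel b n) :=
  ⟨fun w ↦ by
    change IsProbabilityMeasure (pairMeasure b n w)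
    unfold pairMeasure
    infer_instance⟩

/-- The simple graph in which the vertices `i < j` are adjacent iff the indicator of `(i, j)` is
`true`. -/
def graphOf (n : ℕ) (x : Pairs n → Bool) : SimpleGraph (Fin n) :=
  SimpleGraph.fromRel fun i j ↦ ∃ h : i < j, x ⟨(i, j), h⟩ = true

/-- The law of the random graph on `n` vertices: the weights `W_i` are i.i.d. with law `μ`, and
given the weights each pair `i < j` is joined independently with probability
`1 - exp (-b W_i W_j / n)`. -/
def graphLaw (μ : Measure ℝ) (b : ℝ) (n : ℕ) : Measure (SimpleGraph (Fin n)) :=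
  ((Measure.pi fun _ : Fin n ↦ μ).bind (pairKernel b n)).map (graphOf n)

instance (μ : Measure ℝ) [IsProbabilityMeasure μ] (b : ℝ) (n : ℕ) :
    IsProbabilityMeasure (graphLaw μ b n) := by
  have : IsProbabilityMeasure ((Measure.pi fun _ : Fin n ↦ μ).bind (pairKernel b n)) :=
    inferInstance
  exact Measure.isProbabilityMeasure_map Measurable.of_discrete.aemeasurable

/-- The events `E n` hold with high probability. -/
def Whp {Ω : ℕ → Type} [∀ n, MeasurableSpace (Ω n)] (P : ∀ n, Measure (Ω n))
    (E : ∀ n, Set (Ω n)) : Prop :=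
  Tendsto (fun n ↦ (P n).real (E n)) atTop (𝓝 1)

/-- `X n = o_p(1)`: for every `ε > 0`, `P (|X n| > ε)` tends to `0`. -/
def IsLittleOpOne {Ω : ℕ → Type} [∀ n, MeasurableSpace (Ω n)] (P : ∀ n, Measure (Ω n))
    (X : ∀ n, Ω n → ℝ) : Prop :=
  ∀ ε : ℝ, 0 < ε → Tendsto (fun n ↦ (P n).real {ω | ε < |X n ω|}) atTop (𝓝 0)

/-- `X n = O_p(1)`: for every `ε > 0` there is `C` with `P (|X n| > C) ≤ ε` for every `n`. -/
def IsBigOpOne {Ω : ℕ → Type} [∀ n, MeasurableSpace (Ω n)] (P : ∀ n, Measure (Ω n))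
    (X : ∀ n, Ω n → ℝ) : Prop :=
  ∀ ε : ℝ, 0 < ε → ∃ C : ℝ, ∀ n, (P n).real {ω | C < |X n ω|} ≤ ε

end PoissonianGraph

end

open PoissonianGraph

/-! Fix a level `L` and call a vertex heavy if its weight exceeds `L`, light otherwise. A clique is
a set of heavy vertices together with a light clique, so if no light clique on `k` vertices exists,
the clique number is less than `k` plus the number of heavy vertices
(`cliqueNum_lt_of_no_lightClique`). The number of heavy vertices is binomial with mean `n P(W > L)`
and is handled by Chebyshev; light cliques are handled by first moments. The regimes differ in the
choice of `L`. To have one product space for all estimates, an edge is realised by comparing an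
independent uniform variable with the edge probability (`graphLaw_eq_map`).

Case α < 2: take `L² = A n log n / b`. Two vertices at this level are non-adjacent with probability
`n⁻ᴬ`, and the mean number of heavy vertices is `a b^(α/2) A^(-α/2)` times the claimed order of
magnitude. If `A < 1 - α/2`, light cliques have size at most of order `nᴬ log n`, which is
negligible, giving an upper bound (`tendsto_real_cliqueNum_gt`). If `A > 1 - α/2`, the heavy
vertices miss so few edges that deleting one endpoint of each missing pair costs a negligible number
of vertices, giving a lower bound (`tendsto_real_cliqueNum_lt`). Letting `A → 1 - α/2` identifies
the constant.

Case α = 2: take `L = η √n`. The mean number of heavy vertices is the constant `a / η²`, and the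
expected number of light 4-cliques is bounded by a constant that is small with `η`. Conversely, for
a suitable multiple of `√n` there are at least `k` heavy vertices with probability bounded below,
and their mutual edge probabilities are bounded below, so a `k`-clique appears with probability
bounded below.

Case α > 2: take `L = √n`. With high probability there is no heavy vertex and no light 4-clique, and
there is an edge. The probability of having no light triangle converges to that of a Poisson
variable being zero (`tendsto_real_no_lightTriangle`). Only `E W² < ∞` is available, so the higher
moments met in the error terms are truncated at `√n`; the moment of order `2 + k` is then
`o(n^(k/2))` by dominated convergence, which is just enough. -/

namespace PoissonianGraph

/-! ### Coupling of the graph with independent weights and uniform variables -/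

/-- The uniform distribution on `[0, 1]`. -/
noncomputable def unifMeasure : Measure ℝ := volume.restrict (Set.Icc 0 1)

instance : IsProbabilityMeasure unifMeasure := ⟨by simp [unifMeasure]⟩

theorem unifMeasure_real_Iio (p : unitInterval) : unifMeasure.real (Set.Iio (p : ℝ)) = p := by
  have h : Set.Iio (p : ℝ) ∩ Set.Icc 0 1 = Set.Ico 0 (p : ℝ) := by
    ext x
    have := p.2.2
    simp only [Set.mem_inter_iff, Set.mem_Iio, Set.mem_Icc, Set.mem_Ico]
    grind
  rw [unifMeasure, measureReal_restrict_apply measurableSet_Iio, h]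
  simp [p.2.1]

theorem unifMeasure_real_Ici (p : unitInterval) :
    unifMeasure.real (Set.Ici (p : ℝ)) = 1 - p := by
  rw [← Set.compl_Iio, probReal_compl_eq_one_sub measurableSet_Iio, unifMeasure_real_Iio]

/-- The law of the independent weights and uniform variables that drive the random graph. -/
noncomputable def seedMeasure (μ : Measure ℝ) (n : ℕ) : Measure (Fin n ⊕ Pairs n → ℝ) :=
  Measure.pi (Sum.elim (fun _ ↦ μ) fun _ ↦ unifMeasure)

instance (μ : Measure ℝ) [IsProbabilityMeasure μ] (n : ℕ) (i : Fin n ⊕ Pairs n) :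
    IsProbabilityMeasure (Sum.elim (fun _ : Fin n ↦ μ) (fun _ : Pairs n ↦ unifMeasure) i) := by
  cases i <;> (simp only [Sum.elim_inl, Sum.elim_inr]; infer_instance)

instance (μ : Measure ℝ) [IsProbabilityMeasure μ] (n : ℕ) :
    IsProbabilityMeasure (seedMeasure μ n) := by
  unfold seedMeasure; infer_instance

/-- The pair `e` is an edge of the graph driven by the seed `ω`. -/
def SeedEdge (b : ℝ) (n : ℕ) (ω : Fin n ⊕ Pairs n → ℝ) (e : Pairs n) : Prop :=
  ω (.inr e) < edgeProb b n (ω (.inl e.1.1)) (ω (.inl e.1.2))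

open Classical in
/-- The graph driven by the seed `ω`. -/
noncomputable def seedGraph (b : ℝ) (n : ℕ) (ω : Fin n ⊕ Pairs n → ℝ) : SimpleGraph (Fin n) :=
  graphOf n fun e ↦ decide (SeedEdge b n ω e)

theorem measurable_coe_edgeProb (b : ℝ) (n : ℕ) (i j : Fin n) :
    Measurable fun w : Fin n → ℝ ↦ (edgeProb b n (w i) (w j) : ℝ) :=
  (measurable_edgeProb b n i j).subtype_val

theorem measurableSet_seedEdge (b : ℝ) (n : ℕ) (e : Pairs n) :
    MeasurableSet {ω | SeedEdge b n ω e} := by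
  unfold SeedEdge
  refine measurableSet_lt (measurable_pi_apply _) ?_
  exact (measurable_coe_edgeProb b n e.1.1 e.1.2).comp (g := fun w : Fin n → ℝ ↦
    (edgeProb b n (w e.1.1) (w e.1.2) : ℝ)) (f := fun (ω : Fin n ⊕ Pairs n → ℝ) i ↦ ω (.inl i))
    (by fun_prop)

open Classical in
theorem measurable_decide_seedEdge (b : ℝ) (n : ℕ) :
    Measurable fun (ω : Fin n ⊕ Pairs n → ℝ) (e : Pairs n) ↦ decide (SeedEdge b n ω e) :=
  measurable_pi_lambda _ fun e ↦ measurable_to_bool <| by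
    simpa [Set.preimage] using measurableSet_seedEdge b n e

theorem measurable_seedGraph (b : ℝ) (n : ℕ) : Measurable (seedGraph b n) :=
  Measurable.of_discrete.comp (measurable_decide_seedEdge b n)

theorem measurableSet_simpleGraph {n : ℕ} (s : Set (SimpleGraph (Fin n))) : MeasurableSet s := by
  rw [← s.preimage_image_eq (f := SimpleGraph.edgeSet) SimpleGraph.edgeSet_injective]
  exact SimpleGraph.measurable_edgeSet (Set.Finite.measurableSet (Set.toFinite _))

theorem measurePreserving_seed (μ : Measure ℝ) [IsProbabilityMeasure μ] (n : ℕ) :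
    MeasurePreserving (MeasurableEquiv.sumPiEquivProdPi fun _ : Fin n ⊕ Pairs n ↦ ℝ).symm
      ((Measure.pi fun _ ↦ μ).prod (Measure.pi fun _ ↦ unifMeasure)) (seedMeasure μ n) :=
  measurePreserving_sumPiEquivProdPi_symm (X := fun _ : Fin n ⊕ Pairs n ↦ ℝ)
    (Sum.elim (fun _ ↦ μ) fun _ ↦ unifMeasure)

theorem seedMeasure_apply (μ : Measure ℝ) [IsProbabilityMeasure μ] {n : ℕ}
    {s : Set (Fin n ⊕ Pairs n → ℝ)} (hs : MeasurableSet s) :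
    seedMeasure μ n s = ∫⁻ w, (Measure.pi fun _ : Pairs n ↦ unifMeasure)
      {u | Sum.elim w u ∈ s} ∂Measure.pi fun _ : Fin n ↦ μ := by
  rw [← (measurePreserving_seed μ n).measure_preimage_equiv, Measure.prod_apply]
  · refine lintegral_congr fun w ↦ congrArg _ ?_
    ext u
    simp only [Set.mem_preimage, Set.mem_ofPred_eq]
    congr!
  · exact MeasurableEquiv.measurable _ hs

theorem measurable_decide_lt (p : ℝ) : Measurable fun u : ℝ ↦ decide (u < p) :=
  measurable_to_bool <| by
    rw [show (fun u : ℝ ↦ decide (u < p)) ⁻¹' {true} = Set.Iio p by ext; simp]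
    exact measurableSet_Iio

theorem map_unifMeasure (p : unitInterval) :
    unifMeasure.map (fun u ↦ decide (u < (p : ℝ))) = bernoulliMeasure true false p := by
  have hm := measurable_decide_lt p
  have := Measure.isProbabilityMeasure_map (μ := unifMeasure) hm.aemeasurable
  have hb : IsProbabilityMeasure (bernoulliMeasure true false p) := inferInstance
  have h1 : (unifMeasure.map fun u ↦ decide (u < (p : ℝ))).real {true} = p := by
    rw [map_measureReal_apply hm (measurableSet_singleton _)]
    refine Eq.trans ?_ (unifMeasure_real_Iio p)
    congr 1; ext; simp
  have h2 : (bernoulliMeasure true false p).real {true} = p := by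
    simp
  have h3 : ({false} : Set Bool) = {true}ᶜ := by ext x; cases x <;> simp
  refine Measure.ext_of_singleton fun x ↦ ?_
  rw [← measureReal_eq_measureReal_iff]
  cases x
  · rw [h3, probReal_compl_eq_one_sub .of_discrete, probReal_compl_eq_one_sub .of_discrete, h1, h2]
  · rw [h1, h2]

/-- Given the weights, thresholding independent uniforms at the edge probabilities yields
independent Bernoulli variables. From here on every event is a function of independent coordinates,
and events using disjoint coordinates are independent. -/
theorem graphLaw_eq_map (μ : Measure ℝ) [IsProbabilityMeasure μ] (b : ℝ) (n : ℕ) :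
    graphLaw μ b n = (seedMeasure μ n).map (seedGraph b n) := by
  classical
  have hpair : ∀ w, (pairKernel b n) w = (Measure.pi fun _ : Pairs n ↦ unifMeasure).map
      fun u e ↦ decide (u e < (edgeProb b n (w e.1.1) (w e.1.2) : ℝ)) := by
    intro w
    have hm : ∀ e : Pairs n, Measurable fun u : ℝ ↦
        decide (u < (edgeProb b n (w e.1.1) (w e.1.2) : ℝ)) := fun e ↦ measurable_decide_lt _
    have := fun e : Pairs n ↦ Measure.isProbabilityMeasure_map (μ := unifMeasure)
      (hm e).aemeasurable
    rw [Measure.pi_map_pi fun e ↦ (hm e).aemeasurable]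
    simp_rw [map_unifMeasure]
    rfl
  rw [graphLaw]
  have hg : seedGraph b n = graphOf n ∘ fun ω e ↦ decide (SeedEdge b n ω e) := rfl
  rw [hg, ← Measure.map_map .of_discrete (measurable_decide_seedEdge b n)]
  congr 1
  ext s hs
  rw [Measure.bind_apply hs (pairKernel b n).aemeasurable,
    Measure.map_apply (measurable_decide_seedEdge b n) hs,
    seedMeasure_apply μ (measurable_decide_seedEdge b n hs)]
  refine lintegral_congr fun w ↦ ?_
  rw [hpair, Measure.map_apply _ hs]
  · rfl
  · exact measurable_pi_lambda _ fun e ↦ measurable_to_bool <| by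
      simpa [Set.preimage] using measurableSet_lt (measurable_pi_apply e) measurable_const

theorem graphLaw_real (μ : Measure ℝ) [IsProbabilityMeasure μ] (b : ℝ) (n : ℕ)
    (s : Set (SimpleGraph (Fin n))) :
    (graphLaw μ b n).real s = (seedMeasure μ n).real {ω | seedGraph b n ω ∈ s} := by
  rw [graphLaw_eq_map, map_measureReal_apply (measurable_seedGraph b n)
    (measurableSet_simpleGraph s)]
  rfl

/-! ### Cliques, pairs inside a vertex set, and degrees -/

/-- The pairs with both endpoints in `S`. -/
def pairsIn {n : ℕ} (S : Finset (Fin n)) : Finset (Pairs n) :=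
  Finset.univ.filter fun e ↦ e.1.1 ∈ S ∧ e.1.2 ∈ S

theorem mem_pairsIn {n : ℕ} {S : Finset (Fin n)} {e : Pairs n} :
    e ∈ pairsIn S ↔ e.1.1 ∈ S ∧ e.1.2 ∈ S := by
  simp [pairsIn]

theorem seedGraph_adj {b : ℝ} {n : ℕ} {ω : Fin n ⊕ Pairs n → ℝ} {i j : Fin n} (h : i < j) :
    (seedGraph b n ω).Adj i j ↔ SeedEdge b n ω ⟨(i, j), h⟩ := by
  simp [seedGraph, graphOf, h, h.ne, h.not_gt]

theorem seedGraph_isClique {b : ℝ} {n : ℕ} {ω : Fin n ⊕ Pairs n → ℝ} {S : Finset (Fin n)} :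
    (seedGraph b n ω).IsClique (S : Set (Fin n)) ↔ ∀ e ∈ pairsIn S, SeedEdge b n ω e := by
  constructor
  · intro h e he
    rw [mem_pairsIn] at he
    exact (seedGraph_adj e.2).1 (h he.1 he.2 e.2.ne)
  · intro h i hi j hj hij
    rcases hij.lt_or_gt with hlt | hlt
    · exact (seedGraph_adj hlt).2 (h _ (mem_pairsIn.2 ⟨hi, hj⟩))
    · exact ((seedGraph_adj hlt).2 (h _ (mem_pairsIn.2 ⟨hj, hi⟩))).symm

theorem le_cliqueNum_iff {n : ℕ} {G : SimpleGraph (Fin n)} {k : ℕ} :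
    k ≤ G.cliqueNum ↔ ∃ S : Finset (Fin n), S.card = k ∧ G.IsClique (S : Set (Fin n)) := by
  constructor
  · intro h
    obtain ⟨s, hs⟩ := G.exists_isNClique_cliqueNum
    obtain ⟨t, hts, ht⟩ := Finset.exists_subset_card_eq (hs.card_eq.symm ▸ h)
    exact ⟨t, ht, hs.isClique.subset (by exact_mod_cast hts)⟩
  · rintro ⟨S, rfl, hS⟩
    exact hS.card_le_cliqueNum

theorem prod_offDiag {n : ℕ} {M : Type*} [CommMonoid M] (S : Finset (Fin n))
    (f : Fin n → Fin n → M) :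
    ∏ p ∈ S.offDiag, f p.1 p.2 = ∏ e ∈ pairsIn S, f e.1.1 e.1.2 * f e.1.2 e.1.1 := by
  rw [Finset.prod_mul_distrib, ← Finset.prod_filter_mul_prod_filter_not _ fun p ↦ p.1 < p.2]
  congr 1
  · refine (Finset.prod_bij (fun e _ ↦ e.1) ?_ ?_ ?_ ?_).symm
    · intro e he
      rw [mem_pairsIn] at he
      simp [he, e.2, e.2.ne]
    · intro e _ e' _ h
      exact Subtype.ext h
    · intro p hp
      simp only [Finset.mem_filter, Finset.mem_offDiag] at hp
      exact ⟨⟨p, hp.2⟩, mem_pairsIn.2 ⟨hp.1.1, hp.1.2.1⟩, rfl⟩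
    · intros; rfl
  · refine (Finset.prod_bij (fun e _ ↦ e.1.swap) ?_ ?_ ?_ ?_).symm
    · intro e he
      rw [mem_pairsIn] at he
      simp [he, e.2.le, e.2.ne']
    · intro e _ e' _ h
      exact Subtype.ext (Prod.swap_injective h)
    · intro p hp
      simp only [Finset.mem_filter, Finset.mem_offDiag, not_lt] at hp
      exact ⟨⟨p.swap, lt_of_le_of_ne hp.2 hp.1.2.2.symm⟩, mem_pairsIn.2 ⟨hp.1.2.1, hp.1.1⟩, rfl⟩
    · intros; rfl

theorem sum_offDiag {n : ℕ} {M : Type*} [AddCommMonoid M] (S : Finset (Fin n))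
    (f : Fin n → Fin n → M) :
    ∑ p ∈ S.offDiag, f p.1 p.2 = ∑ e ∈ pairsIn S, (f e.1.1 e.1.2 + f e.1.2 e.1.1) :=
  prod_offDiag (M := Multiplicative M) S f

theorem two_mul_card_pairsIn {n : ℕ} (S : Finset (Fin n)) :
    2 * (pairsIn S).card = S.card * (S.card - 1) := by
  have := sum_offDiag S fun _ _ ↦ 1
  rw [Finset.sum_const, Finset.sum_const, Finset.offDiag_card] at this
  rw [Nat.mul_sub, mul_one]
  simp at this
  omega

theorem pairsIn_inter {n : ℕ} (S T : Finset (Fin n)) :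
    pairsIn (S ∩ T) = pairsIn S ∩ pairsIn T := by
  ext e; simp only [mem_pairsIn, Finset.mem_inter]; tauto

theorem pairsIn_mono {n : ℕ} {S T : Finset (Fin n)} (h : S ⊆ T) : pairsIn S ⊆ pairsIn T := by
  intro e; simp only [mem_pairsIn]; exact fun he ↦ ⟨h he.1, h he.2⟩

/-- The number of pairs in `E` that contain the vertex `i`. -/
def pairDegree {n : ℕ} (E : Finset (Pairs n)) (i : Fin n) : ℕ :=
  (E.filter fun e ↦ e.1.1 = i).card + (E.filter fun e ↦ e.1.2 = i).card

/-- Regrouping edges by endpoints turns a product over edges into one over vertices, whose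
expectation factors because the weights are independent. -/
theorem prod_pairs_eq {n : ℕ} {S : Finset (Fin n)} {E : Finset (Pairs n)} (hE : E ⊆ pairsIn S)
    (f : Fin n → ℝ) :
    ∏ e ∈ E, f e.1.1 * f e.1.2 = ∏ i ∈ S, f i ^ pairDegree E i := by
  simp_rw [pairDegree, pow_add]
  rw [Finset.prod_mul_distrib, Finset.prod_mul_distrib]
  congr 1
  · rw [← Finset.prod_fiberwise_of_maps_to (fun e he ↦ (mem_pairsIn.1 (hE he)).1)]
    refine Finset.prod_congr rfl fun i _ ↦ ?_
    rw [Finset.prod_congr rfl fun e he ↦ by rw [(Finset.mem_filter.1 he).2], Finset.prod_const]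
  · rw [← Finset.prod_fiberwise_of_maps_to (fun e he ↦ (mem_pairsIn.1 (hE he)).2)]
    refine Finset.prod_congr rfl fun i _ ↦ ?_
    rw [Finset.prod_congr rfl fun e he ↦ by rw [(Finset.mem_filter.1 he).2], Finset.prod_const]

theorem pairDegree_pairsIn {n : ℕ} {S : Finset (Fin n)} {i : Fin n} (hi : i ∈ S) :
    pairDegree (pairsIn S) i = S.card - 1 := by
  have := sum_offDiag S fun x _ ↦ if x = i then 1 else 0
  rw [Finset.sum_add_distrib, ← Finset.card_filter, ← Finset.card_filter, ← Finset.card_filter]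
    at this
  rw [pairDegree, ← this, ← Finset.card_erase_of_mem hi]
  refine Finset.card_bij (fun p _ ↦ p.2) ?_ ?_ ?_
  · rintro ⟨x, y⟩ h
    simp only [Finset.mem_filter, Finset.mem_offDiag] at h
    obtain ⟨⟨_, h2, h3⟩, rfl⟩ := h
    simp [h2, Ne.symm h3]
  · rintro ⟨x, y⟩ h ⟨x', y'⟩ h' heq
    simp only [Finset.mem_filter] at h h'
    grind
  · intro y hy
    rw [Finset.mem_erase] at hy
    exact ⟨(i, y), by simp [hi, hy.2, hy.1.symm], rfl⟩

theorem pairDegree_pairsIn_of_notMem {n : ℕ} {S : Finset (Fin n)} {i : Fin n} (hi : i ∉ S) :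
    pairDegree (pairsIn S) i = 0 := by
  simp only [pairDegree, Nat.add_eq_zero_iff, Finset.card_eq_zero, Finset.filter_eq_empty_iff,
    mem_pairsIn]
  exact ⟨by rintro e he rfl; exact hi he.1, by rintro e he rfl; exact hi he.2⟩

/-- Inclusion–exclusion at a vertex; it yields the degrees in a union of two overlapping triangles.
-/
theorem pairDegree_union_add_inter {n : ℕ} (E F : Finset (Pairs n)) (i : Fin n) :
    pairDegree (E ∪ F) i + pairDegree (E ∩ F) i = pairDegree E i + pairDegree F i := by
  have h1 := Finset.card_union_add_card_inter (E.filter fun e ↦ e.1.1 = i)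
    (F.filter fun e ↦ e.1.1 = i)
  have h2 := Finset.card_union_add_card_inter (E.filter fun e ↦ e.1.2 = i)
    (F.filter fun e ↦ e.1.2 = i)
  rw [← Finset.filter_union, ← Finset.filter_inter_distrib] at h1 h2
  simp only [pairDegree]
  omega

/-! ### Probabilities in the seed space -/

section
variable (μ : Measure ℝ) [IsProbabilityMeasure μ] {n : ℕ}

theorem seedMeasure_real_eq_integral {s : Set (Fin n ⊕ Pairs n → ℝ)} (hs : MeasurableSet s) :
    (seedMeasure μ n).real s = ∫ w, (Measure.pi fun _ : Pairs n ↦ unifMeasure).real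
      {u | Sum.elim w u ∈ s} ∂Measure.pi fun _ : Fin n ↦ μ := by
  rw [measureReal_def, seedMeasure_apply μ hs, ← integral_toReal]
  · rfl
  · have : {p : (Fin n → ℝ) × (Pairs n → ℝ) | Sum.elim p.1 p.2 ∈ s} =
        (MeasurableEquiv.sumPiEquivProdPi fun _ : Fin n ⊕ Pairs n ↦ ℝ).symm ⁻¹' s := by
      ext p
      simp only [Set.mem_preimage, Set.mem_ofPred_eq]
      congr!
    exact (measurable_measure_prodMk_left (ν := Measure.pi fun _ : Pairs n ↦ unifMeasure)
      (this ▸ MeasurableEquiv.measurable _ hs)).aemeasurable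
  · exact Eventually.of_forall fun w ↦ measure_lt_top _ _

theorem pi_real_forall_mem {ι : Type*} [Fintype ι] (ν : Measure ℝ) [IsProbabilityMeasure ν]
    (E : Finset ι) (A : ι → Set ℝ) :
    (Measure.pi fun _ : ι ↦ ν).real {u | ∀ e ∈ E, u e ∈ A e} = ∏ e ∈ E, ν.real (A e) := by
  classical
  have : {u : ι → ℝ | ∀ e ∈ E, u e ∈ A e} =
      Set.univ.pi fun e ↦ if e ∈ E then A e else Set.univ := by
    ext u
    simp only [Set.mem_ofPred_eq, Set.mem_pi, Set.mem_univ, true_imp_iff]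
    refine forall_congr' fun e ↦ ?_
    split_ifs with h <;> simp [h]
  rw [this, measureReal_def, Measure.pi_pi, ENNReal.toReal_prod, ← Finset.prod_subset
    (Finset.subset_univ E)]
  · refine Finset.prod_congr rfl fun e he ↦ ?_
    simp [he, measureReal_def]
  · intro e _ he
    simp [he]

theorem measurableSet_forall_seedEdge (b : ℝ) (E : Finset (Pairs n)) :
    MeasurableSet {ω | ∀ e ∈ E, SeedEdge b n ω e} := by
  simp only [Set.ofPred_forall]
  exact Finset.measurableSet_biInter _ fun e _ ↦ measurableSet_seedEdge b n e

theorem measurable_weights : Measurable fun (ω : Fin n ⊕ Pairs n → ℝ) (i : Fin n) ↦ ω (.inl i) := by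
  fun_prop

/-- Fubini: with the weights frozen, the edges of `E` depend on distinct uniforms. All first-moment
estimates start from this formula. -/
theorem seedMeasure_real_weights_inter_edges (b : ℝ) {B : Set (Fin n → ℝ)} (hB : MeasurableSet B)
    (E : Finset (Pairs n)) :
    (seedMeasure μ n).real {ω | (fun i ↦ ω (.inl i)) ∈ B ∧ ∀ e ∈ E, SeedEdge b n ω e} =
      ∫ w, B.indicator 1 w * ∏ e ∈ E, (edgeProb b n (w e.1.1) (w e.1.2) : ℝ)
        ∂Measure.pi fun _ : Fin n ↦ μ := by
  have hs : MeasurableSet {ω : Fin n ⊕ Pairs n → ℝ |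
      (fun i ↦ ω (.inl i)) ∈ B ∧ ∀ e ∈ E, SeedEdge b n ω e} :=
    (measurable_weights hB).inter (measurableSet_forall_seedEdge b E)
  rw [seedMeasure_real_eq_integral μ hs]
  refine integral_congr_ae (.of_forall fun w ↦ ?_)
  by_cases hw : w ∈ B
  · have := pi_real_forall_mem unifMeasure E fun e ↦
      Set.Iio (edgeProb b n (w e.1.1) (w e.1.2) : ℝ)
    simp only [unifMeasure_real_Iio] at this
    simp only [Set.indicator_of_mem hw, Pi.one_apply, one_mul, ← this]
    congr 1
    ext u
    simp [hw, SeedEdge]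
  · simp [hw]

/-- If, given any weights in `B`, the event `s` has conditional probability at most `c`, then its
probability is at most `c P(B) + P(Bᶜ)`. -/
theorem seedMeasure_real_le_of_conditional {s : Set (Fin n ⊕ Pairs n → ℝ)} (hs : MeasurableSet s)
    {B : Set (Fin n → ℝ)} (hB : MeasurableSet B) {c : ℝ}
    (h : ∀ w ∈ B, (Measure.pi fun _ : Pairs n ↦ unifMeasure).real {u | Sum.elim w u ∈ s} ≤ c) :
    (seedMeasure μ n).real s ≤ c * (Measure.pi fun _ : Fin n ↦ μ).real B +
      (Measure.pi fun _ : Fin n ↦ μ).real Bᶜ := by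
  rw [seedMeasure_real_eq_integral μ hs, ← integral_indicator_one hB.compl,
    ← integral_indicator_one hB, ← integral_const_mul, ← integral_add]
  · refine integral_mono_of_nonneg (.of_forall fun _ ↦ measureReal_nonneg) ?_
      (.of_forall fun w ↦ ?_)
    · exact (((integrable_const 1).indicator hB).const_mul c).add
        ((integrable_const 1).indicator hB.compl)
    · by_cases hw : w ∈ B
      · simpa [hw] using h w hw
      · simp [hw]
  · exact ((integrable_const 1).indicator hB).const_mul c
  · exact (integrable_const 1).indicator hB.compl

theorem map_weights_seedMeasure :
    (seedMeasure μ n).map (fun ω i ↦ ω (.inl i)) = Measure.pi fun _ : Fin n ↦ μ := by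
  have h := (measurePreserving_seed μ n).symm.map_eq
  have h2 : (fun (ω : Fin n ⊕ Pairs n → ℝ) (i : Fin n) ↦ ω (.inl i)) =
      Prod.fst ∘ (MeasurableEquiv.sumPiEquivProdPi fun _ : Fin n ⊕ Pairs n ↦ ℝ) := rfl
  rw [h2, ← Measure.map_map measurable_fst (MeasurableEquiv.measurable _)]
  erw [h]
  simp

theorem seedMeasure_real_weights {B : Set (Fin n → ℝ)} (hB : MeasurableSet B) :
    (seedMeasure μ n).real {ω | (fun i ↦ ω (.inl i)) ∈ B} =
      (Measure.pi fun _ : Fin n ↦ μ).real B := by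
  rw [← map_weights_seedMeasure μ, map_measureReal_apply measurable_weights hB]
  rfl

end

/-! ### Poisson approximation for events with local dependence -/

theorem prod_sub_prod_le_sum {ι : Type*} [DecidableEq ι] {S T : Finset ι} (hST : S ⊆ T)
    {x : ι → ℝ} (h0 : ∀ i, 0 ≤ x i) (h1 : ∀ i, x i ≤ 1) :
    0 ≤ ∏ i ∈ S, (1 - x i) - ∏ i ∈ T, (1 - x i) ∧
      ∏ i ∈ S, (1 - x i) - ∏ i ∈ T, (1 - x i) ≤ ∑ i ∈ T \ S, x i := by
  have hS0 : 0 ≤ ∏ i ∈ S, (1 - x i) := Finset.prod_nonneg fun i _ ↦ by linarith [h1 i]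
  have hS1 : ∏ i ∈ S, (1 - x i) ≤ 1 :=
    Finset.prod_le_one (fun i _ ↦ by linarith [h1 i]) fun i _ ↦ by linarith [h0 i]
  have hD0 : 0 ≤ ∏ i ∈ T \ S, (1 - x i) := Finset.prod_nonneg fun i _ ↦ by linarith [h1 i]
  have hD1 : ∏ i ∈ T \ S, (1 - x i) ≤ 1 :=
    Finset.prod_le_one (fun i _ ↦ by linarith [h1 i]) fun i _ ↦ by linarith [h0 i]
  have hD : 1 - ∏ i ∈ T \ S, (1 - x i) ≤ ∑ i ∈ T \ S, x i := by
    have key : ∀ U : Finset ι, 1 - ∏ i ∈ U, (1 - x i) ≤ ∑ i ∈ U, x i := by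
      intro U
      induction U using Finset.induction_on with
      | empty => simp
      | insert i U hi ih =>
        rw [Finset.prod_insert hi, Finset.sum_insert hi]
        have hU : ∏ i ∈ U, (1 - x i) ≤ 1 :=
          Finset.prod_le_one (fun i _ ↦ by linarith [h1 i]) fun i _ ↦ by linarith [h0 i]
        nlinarith [h0 i]
    exact key _
  rw [← Finset.prod_sdiff hST]
  constructor
  · nlinarith
  · nlinarith

/-- A Gronwall-type estimate: if `|F' + l F| ≤ δ` on `[0, 1]` and `F 0 = 1`, then
`F 1` is within `δ` of `exp (-l)`. -/
theorem abs_sub_exp_neg_le {F F' : ℝ → ℝ} {l δ : ℝ} (hl : 0 ≤ l) (h0 : F 0 = 1)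
    (hF : ∀ s, HasDerivAt F (F' s) s)
    (h : ∀ s ∈ Set.Icc (0 : ℝ) 1, |F' s + l * F s| ≤ δ) :
    |F 1 - Real.exp (-l)| ≤ δ := by
  have hd : ∀ s, HasDerivAt (fun s ↦ Real.exp (l * s) * F s)
      (Real.exp (l * s) * (F' s + l * F s)) s := by
    intro s
    have h1 : HasDerivAt (fun s ↦ Real.exp (l * s)) (Real.exp (l * s) * l) s := by
      simpa using ((hasDerivAt_id s).const_mul l).exp
    exact (h1.mul (hF s)).congr_deriv (by ring)
  have hb : ∀ s ∈ Set.Icc (0 : ℝ) 1, ‖Real.exp (l * s) * (F' s + l * F s)‖ ≤ Real.exp l * δ := by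
    intro s hs
    rw [norm_mul, Real.norm_eq_abs, Real.norm_eq_abs, Real.abs_exp]
    gcongr
    · nlinarith [hs.2]
    · exact h s hs
  have := (convex_Icc (0 : ℝ) 1).norm_image_sub_le_of_norm_hasDerivWithin_le
    (fun s _ ↦ (hd s).hasDerivWithinAt) hb (Set.left_mem_Icc.2 zero_le_one)
    (Set.right_mem_Icc.2 zero_le_one)
  simp only [mul_one, mul_zero, Real.exp_zero, h0, sub_zero, norm_one, Real.norm_eq_abs] at this
  have h2 : F 1 - Real.exp (-l) = Real.exp (-l) * (Real.exp l * F 1 - 1) := by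
    rw [mul_sub, ← mul_assoc, ← Real.exp_add]; simp
  rw [h2, abs_mul, Real.abs_exp]
  calc _ ≤ Real.exp (-l) * (Real.exp l * δ) := by gcongr
    _ = δ := by rw [← mul_assoc, ← Real.exp_add]; simp

section
variable {Ω ι : Type*} [MeasurableSpace Ω] [Fintype ι] [DecidableEq ι] (P : Measure Ω)
  [IsProbabilityMeasure P]

/-- **Poisson approximation** of the probability that none of the events `A i` occurs, when `A i`
is independent of the events outside its neighbourhood `N i`. -/
theorem abs_real_forall_notMem_sub_exp_le {A : ι → Set Ω} (hA : ∀ i, MeasurableSet (A i))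
    {N : ι → Finset ι} (hN : ∀ i, i ∈ N i)
    (hind : ∀ i, ∀ s : ℝ, ∫ ω, (A i).indicator 1 ω *
      ∏ j ∈ (N i)ᶜ, (1 - s * (A j).indicator 1 ω) ∂P =
        P.real (A i) * ∫ ω, ∏ j ∈ (N i)ᶜ, (1 - s * (A j).indicator 1 ω) ∂P) :
    |P.real {ω | ∀ i, ω ∉ A i} - Real.exp (-∑ i, P.real (A i))| ≤
      ∑ i, ∑ j ∈ N i, P.real (A i) * P.real (A j) +
        ∑ i, ∑ j ∈ (N i).erase i, P.real (A i ∩ A j) := by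
  set I : ι → Ω → ℝ := fun i ↦ (A i).indicator 1 with hI
  have hIm : ∀ i, Measurable (I i) := fun i ↦ measurable_one.indicator (hA i)
  have hI0 : ∀ i ω, 0 ≤ I i ω := fun i ω ↦ Set.indicator_nonneg (by simp) ω
  have hI1 : ∀ i ω, I i ω ≤ 1 := fun i ω ↦ Set.indicator_le_self' (f := 1) (by simp) ω
  have hIint : ∀ i, ∫ ω, I i ω ∂P = P.real (A i) := fun i ↦ integral_indicator_one (hA i)
  have hbd : ∀ (S : Finset ι) (C : ℝ), ∀ s : ℝ, |s| ≤ C → ∀ ω,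
      |∏ j ∈ S, (1 - s * I j ω)| ≤ (1 + C) ^ S.card := by
    intro S C s hs ω
    rw [Finset.abs_prod, ← Finset.prod_const]
    refine Finset.prod_le_prod (fun _ _ ↦ abs_nonneg _) fun j _ ↦ ?_
    calc |1 - s * I j ω| ≤ |1| + |s * I j ω| := abs_sub _ _
      _ ≤ 1 + C := by
        rw [abs_one, abs_mul, abs_of_nonneg (hI0 j ω)]
        nlinarith [hI0 j ω, hI1 j ω, abs_nonneg s]
  have hmS : ∀ (S : Finset ι) (s : ℝ), Measurable fun ω ↦ ∏ j ∈ S, (1 - s * I j ω) := fun S s ↦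
    Finset.measurable_prod _ fun j _ ↦ measurable_const.sub ((hIm j).const_mul s)
  have hint : ∀ (S : Finset ι) (s : ℝ), Integrable (fun ω ↦ ∏ j ∈ S, (1 - s * I j ω)) P :=
    fun S s ↦ Integrable.of_bound (hmS S s).aestronglyMeasurable _
      (.of_forall fun ω ↦ hbd S |s| s le_rfl ω)
  have hintI : ∀ (i : ι) (S : Finset ι) (s : ℝ),
      Integrable (fun ω ↦ I i ω * ∏ j ∈ S, (1 - s * I j ω)) P := fun i S s ↦
    (hint S s).bdd_mul (hIm i).aestronglyMeasurable (c := 1)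
      (.of_forall fun ω ↦ by rw [Real.norm_of_nonneg (hI0 i ω)]; exact hI1 i ω)
  have hintII : ∀ i j, Integrable (fun ω ↦ I i ω * I j ω) P := fun i j ↦ by
    refine Integrable.of_bound ((hIm i).mul (hIm j)).aestronglyMeasurable 1
      (.of_forall fun ω ↦ ?_)
    rw [Real.norm_of_nonneg (mul_nonneg (hI0 i ω) (hI0 j ω))]
    exact mul_le_one₀ (hI1 i ω) (hI0 j ω) (hI1 j ω)
  have hIIint : ∀ i j, ∫ ω, I i ω * I j ω ∂P = P.real (A i ∩ A j) := fun i j ↦ by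
    rw [← integral_indicator_one ((hA i).inter (hA j))]
    congr 1 with ω
    rw [Set.inter_indicator_one]
    rfl
  have hI' : ∀ i, Integrable (I i) P := fun i ↦ (integrable_const 1).indicator (hA i)
  -- This interpolates between `F 0 = 1` and `F 1`, the probability that no event occurs. With `l`
  -- the sum of the probabilities, exact independence would make `F' + l F` small, and the Gronwall
  -- estimate then compares `F 1` with `exp (-l)`.
  set F : ℝ → ℝ := fun s ↦ ∫ ω, ∏ j, (1 - s * I j ω) ∂P with hF
  set F' : ℝ → ℝ := fun s ↦ ∫ ω, ∑ i, -(I i ω * ∏ j ∈ Finset.univ.erase i, (1 - s * I j ω)) ∂P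
    with hF'
  have hderiv : ∀ s, HasDerivAt F (F' s) s := by
    intro s
    refine (hasDerivAt_integral_of_dominated_loc_of_deriv_le (𝕜 := ℝ) (μ := P)
      (F := fun s ω ↦ ∏ j, (1 - s * I j ω))
      (F' := fun s ω ↦ ∑ i, -(I i ω * ∏ j ∈ Finset.univ.erase i, (1 - s * I j ω)))
      (bound := fun _ ↦ ∑ i : ι, (1 + (|s| + 1)) ^ (Finset.univ.erase i).card)
      (Metric.ball_mem_nhds s zero_lt_one) (.of_forall fun t ↦ (hmS _ t).aestronglyMeasurable)
      (hint _ s) ?_ (.of_forall fun ω t ht ↦ ?_) (integrable_const _)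
      (.of_forall fun ω t _ ↦ ?_)).2
    · exact (Finset.measurable_sum _ fun i _ ↦
        ((hIm i).mul (hmS _ s)).neg).aestronglyMeasurable
    · refine (norm_sum_le _ _).trans (Finset.sum_le_sum fun i _ ↦ ?_)
      have ht' : |t| ≤ |s| + 1 := by
        rw [Metric.mem_ball, Real.dist_eq] at ht
        have := abs_sub_abs_le_abs_sub t s
        linarith
      have := hbd (Finset.univ.erase i) _ t ht' ω
      rw [norm_neg, norm_mul, Real.norm_of_nonneg (hI0 i ω), Real.norm_eq_abs]
      nlinarith [hI0 i ω, hI1 i ω, abs_nonneg (∏ j ∈ Finset.univ.erase i, (1 - t * I j ω))]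
    · have h1 : ∀ i ∈ (Finset.univ : Finset ι),
          HasDerivAt (fun t : ℝ ↦ 1 - t * I i ω) (-(I i ω)) t := fun i _ ↦ by
        simpa using ((hasDerivAt_id t).mul_const (I i ω)).const_sub 1
      refine (HasDerivAt.fun_finsetProd h1).congr_deriv (Finset.sum_congr rfl fun i _ ↦ ?_)
      simp [mul_comm]
  have h0 : F 0 = 1 := by simp [hF]
  have h1 : F 1 = P.real {ω | ∀ i, ω ∉ A i} := by
    have hm : MeasurableSet {ω | ∀ i, ω ∉ A i} := by
      simp only [Set.ofPred_forall]
      exact MeasurableSet.iInter fun i ↦ (hA i).compl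
    rw [← integral_indicator_one hm]
    refine integral_congr_ae (.of_forall fun ω ↦ ?_)
    by_cases h : ∀ i, ω ∉ A i
    · simp [h, hI]
    · push Not at h
      obtain ⟨i, hi⟩ := h
      rw [Set.indicator_of_notMem (show ω ∉ {ω | ∀ i, ω ∉ A i} from fun h' ↦ h' i hi)]
      exact Finset.prod_eq_zero (Finset.mem_univ i) (by simp [hI, hi])
  rw [← h1]
  refine abs_sub_exp_neg_le (Finset.sum_nonneg fun _ _ ↦ measureReal_nonneg)
    h0 hderiv fun s hs ↦ ?_
  have hx0 : ∀ ω j, 0 ≤ s * I j ω := fun ω j ↦ mul_nonneg hs.1 (hI0 j ω)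
  have hx1 : ∀ ω j, s * I j ω ≤ 1 := fun ω j ↦ mul_le_one₀ hs.2 (hI0 j ω) (hI1 j ω)
  have hxI : ∀ ω j, s * I j ω ≤ I j ω := fun ω j ↦ mul_le_of_le_one_left (hI0 j ω) hs.2
  have hkey : ∀ i, |P.real (A i) * F s -
      ∫ ω, I i ω * ∏ j ∈ Finset.univ.erase i, (1 - s * I j ω) ∂P| ≤
      ∑ j ∈ N i, P.real (A i) * P.real (A j) + ∑ j ∈ (N i).erase i, P.real (A i ∩ A j) := by
    intro i
    have hsub : (N i)ᶜ ⊆ Finset.univ.erase i := by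
      intro j hj
      rw [Finset.mem_compl] at hj
      simp only [Finset.mem_erase, Finset.mem_univ, and_true]
      rintro rfl
      exact hj (hN j)
    -- Both terms are compared with the product over the indices outside `N i`, for which
    -- independence from `A i` is exact. Restoring the factors in `N i` costs a sum of `P(A j)`
    -- here, and of `P(A i ∩ A j)` in `e2`.
    have e1 : 0 ≤ ∫ ω, ∏ j ∈ (N i)ᶜ, (1 - s * I j ω) ∂P - F s ∧
        ∫ ω, ∏ j ∈ (N i)ᶜ, (1 - s * I j ω) ∂P - F s ≤ ∑ j ∈ N i, P.real (A j) := by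
      rw [hF, ← integral_sub (hint _ s) (hint _ s)]
      have h := fun ω ↦ prod_sub_prod_le_sum (Finset.subset_univ (N i)ᶜ) (hx0 ω) (hx1 ω)
      refine ⟨integral_nonneg fun ω ↦ (h ω).1, ?_⟩
      rw [Finset.sum_congr rfl fun j _ ↦ (hIint j).symm, ← integral_finsetSum _ fun j _ ↦ hI' j]
      refine integral_mono ((hint _ s).sub (hint _ s)) (integrable_finsetSum _ fun j _ ↦ hI' j)
        fun ω ↦ (h ω).2.trans ?_
      rw [show Finset.univ \ (N i)ᶜ = N i by ext; simp]
      exact Finset.sum_le_sum fun j _ ↦ hxI ω j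
    have e2 : 0 ≤ ∫ ω, I i ω * ∏ j ∈ (N i)ᶜ, (1 - s * I j ω) ∂P -
          ∫ ω, I i ω * ∏ j ∈ Finset.univ.erase i, (1 - s * I j ω) ∂P ∧
        ∫ ω, I i ω * ∏ j ∈ (N i)ᶜ, (1 - s * I j ω) ∂P -
          ∫ ω, I i ω * ∏ j ∈ Finset.univ.erase i, (1 - s * I j ω) ∂P ≤
          ∑ j ∈ (N i).erase i, P.real (A i ∩ A j) := by
      rw [← integral_sub (hintI i _ s) (hintI i _ s)]
      have h := fun ω ↦ prod_sub_prod_le_sum hsub (hx0 ω) (hx1 ω)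
      refine ⟨integral_nonneg fun ω ↦ ?_, ?_⟩
      · simp only [← mul_sub]
        exact mul_nonneg (hI0 i ω) (h ω).1
      rw [Finset.sum_congr rfl fun j _ ↦ (hIIint i j).symm,
        ← integral_finsetSum _ fun j _ ↦ hintII i j]
      refine integral_mono ((hintI i _ s).sub (hintI i _ s))
        (integrable_finsetSum _ fun j _ ↦ hintII i j) fun ω ↦ ?_
      simp only [← mul_sub, ← Finset.mul_sum]
      refine mul_le_mul_of_nonneg_left ((h ω).2.trans ?_) (hI0 i ω)
      rw [show Finset.univ.erase i \ (N i)ᶜ = (N i).erase i by ext; simp]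
      exact Finset.sum_le_sum fun j _ ↦ hxI ω j
    rw [hind i s] at e2
    have hp := measureReal_nonneg (μ := P) (s := A i)
    rw [← Finset.mul_sum]
    have e3 := mul_nonneg hp e1.1
    have e4 := mul_le_mul_of_nonneg_left e1.2 hp
    have e5 : 0 ≤ ∑ j ∈ N i, P.real (A j) := Finset.sum_nonneg fun _ _ ↦ measureReal_nonneg
    have e6 := mul_nonneg hp e5
    have e7 : 0 ≤ ∑ j ∈ (N i).erase i, P.real (A i ∩ A j) :=
      Finset.sum_nonneg fun _ _ ↦ measureReal_nonneg
    rw [abs_le]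
    constructor <;> linarith [e2.1, e2.2]
  have hsum : F' s + (∑ i, P.real (A i)) * F s = ∑ i, (P.real (A i) * F s -
      ∫ ω, I i ω * ∏ j ∈ Finset.univ.erase i, (1 - s * I j ω) ∂P) := by
    rw [Finset.sum_sub_distrib, Finset.sum_mul, hF']
    simp only
    rw [integral_finsetSum _ fun i _ ↦ by exact (hintI i _ s).neg]
    simp only [integral_neg, Finset.sum_neg_distrib]
    ring
  rw [hsum, ← Finset.sum_add_distrib]
  exact (Finset.abs_sum_le_sum_abs _ _).trans (Finset.sum_le_sum fun i _ ↦ hkey i)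

end

/-! ### Edge probability bounds and first moments of light configurations -/

theorem edgeProb_eq_of_nonneg {b : ℝ} {n : ℕ} {x y : ℝ} (h : 0 ≤ b * (x * y) / n) :
    (edgeProb b n x y : ℝ) = 1 - Real.exp (-(b * (x * y) / n)) := by
  have h1 : Real.exp (-(b * (x * y) / n)) ≤ 1 := by
    rwa [Real.exp_le_one_iff, neg_nonpos]
  have h2 := Real.exp_pos (-(b * (x * y) / n))
  rw [edgeProb, Set.projIcc_of_mem zero_le_one ⟨by linarith, by linarith⟩]

theorem edgeProb_le_one_sub_exp {b : ℝ} (hb : 0 ≤ b) (n : ℕ) {x y t : ℝ} (h : x * y ≤ t)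
    (ht : 0 ≤ t) : (edgeProb b n x y : ℝ) ≤ 1 - Real.exp (-(b * t / n)) := by
  have h1 : Real.exp (-(b * t / n)) ≤ 1 := by
    rw [Real.exp_le_one_iff, neg_nonpos]; positivity
  rw [edgeProb, Set.coe_projIcc]
  refine max_le (by linarith) ((min_le_right _ _).trans ?_)
  gcongr

theorem one_sub_exp_le_edgeProb {b : ℝ} (hb : 0 ≤ b) (n : ℕ) {x y t : ℝ} (h : t ≤ x * y)
    (ht : 0 ≤ t) : 1 - Real.exp (-(b * t / n)) ≤ edgeProb b n x y := by
  have : 0 ≤ x * y := ht.trans h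
  rw [edgeProb_eq_of_nonneg (by positivity)]
  gcongr

theorem edgeProb_le {b : ℝ} (hb : 0 ≤ b) (n : ℕ) (x y : ℝ) :
    (edgeProb b n x y : ℝ) ≤ b / n * (|x| * |y|) := by
  have h := edgeProb_le_one_sub_exp hb n (le_abs_self (x * y)) (abs_nonneg _)
  have h2 := Real.one_sub_le_exp_neg (b * |x * y| / n)
  rw [abs_mul] at h h2
  refine h.trans ?_
  rw [div_mul_eq_mul_div]
  linarith

/-- From `1 - exp (-t) ≥ t / (1 + t)`, where `t ≤ b K² / n` allows a denominator free of the
weights. The product form in `x` and `y` survives, at the price of a factor tending to one when `K²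
= o(n)`. -/
theorem le_edgeProb {b : ℝ} (hb : 0 ≤ b) (n : ℕ) {x y K : ℝ} (hx : 0 ≤ x) (hy : 0 ≤ y)
    (hxK : x ≤ K) (hyK : y ≤ K) :
    b / n / (1 + b / n * K ^ 2) * (x * y) ≤ edgeProb b n x y := by
  rw [edgeProb_eq_of_nonneg (by positivity)]
  set t := b * (x * y) / n with ht
  have ht0 : 0 ≤ t := by positivity
  have h1 : t ≤ b / n * K ^ 2 := by
    rw [ht, mul_div_right_comm, sq]
    gcongr
    exact hx.trans hxK
  have h2 : Real.exp (-t) ≤ 1 / (1 + t) := by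
    rw [Real.exp_neg, ← one_div]
    gcongr
    linarith [Real.add_one_le_exp t]
  calc b / n / (1 + b / n * K ^ 2) * (x * y) = t / (1 + b / n * K ^ 2) := by rw [ht]; ring
    _ ≤ t / (1 + t) := by gcongr
    _ = 1 - 1 / (1 + t) := by field_simp; ring
    _ ≤ _ := by linarith

/-- The vertices of `S` have weight at most `L` and the pairs of `E` are edges. -/
def lightEdges (b : ℝ) (n : ℕ) (L : ℝ) (S : Finset (Fin n)) (E : Finset (Pairs n)) :
    Set (Fin n ⊕ Pairs n → ℝ) :=
  {ω | (∀ i ∈ S, |ω (.inl i)| ≤ L) ∧ ∀ e ∈ E, SeedEdge b n ω e}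

/-- The truncated moment of order `d` of the absolute value. -/
noncomputable def truncMoment (μ : Measure ℝ) (L : ℝ) (d : ℕ) : ℝ :=
  ∫ x, {x | |x| ≤ L}.indicator (fun x ↦ |x| ^ d) x ∂μ

theorem truncMoment_nonneg (μ : Measure ℝ) (L : ℝ) (d : ℕ) : 0 ≤ truncMoment μ L d :=
  integral_nonneg fun _ ↦ Set.indicator_nonneg (fun _ _ ↦ by positivity) _

theorem measurableSet_abs_le (L : ℝ) : MeasurableSet {x : ℝ | |x| ≤ L} :=
  measurableSet_le measurable_id.abs measurable_const

theorem measurableSet_forall_mem {ι : Type*} (S : Finset ι) {A : Set ℝ} (hA : MeasurableSet A) :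
    MeasurableSet {w : ι → ℝ | ∀ i ∈ S, w i ∈ A} := by
  simp only [Set.ofPred_forall]
  exact Finset.measurableSet_biInter _ fun i _ ↦ measurable_pi_apply i hA

theorem measurableSet_lightEdges (b : ℝ) (n : ℕ) (L : ℝ) (S : Finset (Fin n))
    (E : Finset (Pairs n)) : MeasurableSet (lightEdges b n L S E) :=
  (measurable_weights (measurableSet_forall_mem S (measurableSet_abs_le L))).inter
    (measurableSet_forall_seedEdge b E)

section
variable (μ : Measure ℝ) [IsProbabilityMeasure μ] {n : ℕ}

theorem integrable_truncMoment (L : ℝ) (d : ℕ) :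
    Integrable ({x | |x| ≤ L}.indicator fun x : ℝ ↦ |x| ^ d) μ := by
  refine Integrable.of_bound (C := |L| ^ d)
    ((by fun_prop : Measurable fun x : ℝ ↦ |x| ^ d).indicator
      (measurableSet_abs_le L)).aestronglyMeasurable (.of_forall fun x ↦ ?_)
  by_cases hx : |x| ≤ L
  · rw [Set.indicator_of_mem (by exact hx), Real.norm_of_nonneg (by positivity)]
    exact pow_le_pow_left₀ (abs_nonneg x) (hx.trans (le_abs_self L)) d
  · rw [Set.indicator_of_notMem (by exact hx), norm_zero]
    positivity

theorem indicator_forall_mem_mul_prod {ι : Type*} (S : Finset ι) (A : Set ℝ) (d : ι → ℕ)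
    (f : ℝ → ℝ) (w : ι → ℝ) :
    {w : ι → ℝ | ∀ i ∈ S, w i ∈ A}.indicator 1 w * ∏ i ∈ S, f (w i) ^ d i =
      ∏ i ∈ S, A.indicator (fun x ↦ f x ^ d i) (w i) := by
  by_cases h : ∀ i ∈ S, w i ∈ A
  · rw [Set.indicator_of_mem (by exact h), Pi.one_apply, one_mul]
    exact Finset.prod_congr rfl fun i hi ↦ by rw [Set.indicator_of_mem (h i hi)]
  · rw [Set.indicator_of_notMem (by exact h), zero_mul]
    push Not at h
    obtain ⟨i, hi, hiA⟩ := h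
    exact (Finset.prod_eq_zero hi (Set.indicator_of_notMem hiA _)).symm

theorem integral_pi_prod (S : Finset (Fin n)) (g : Fin n → ℝ → ℝ) :
    ∫ w, ∏ i ∈ S, g i (w i) ∂Measure.pi (fun _ : Fin n ↦ μ) = ∏ i ∈ S, ∫ x, g i x ∂μ := by
  have := integral_fintype_prod_eq_prod (μ := fun _ : Fin n ↦ μ)
    (fun i x ↦ if i ∈ S then g i x else 1)
  rw [← Finset.prod_subset (Finset.subset_univ S)
    (fun i _ hi ↦ by simp [hi])] at this
  calc _ = ∫ w : Fin n → ℝ, ∏ i, (if i ∈ S then g i (w i) else 1)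
        ∂Measure.pi (fun _ : Fin n ↦ μ) := by
        simp
    _ = _ := this.trans (Finset.prod_congr rfl fun i hi ↦ by simp [hi])

theorem integrable_pi_prod (S : Finset (Fin n)) {g : Fin n → ℝ → ℝ}
    (hg : ∀ i, Integrable (g i) μ) :
    Integrable (fun w ↦ ∏ i ∈ S, g i (w i)) (Measure.pi fun _ : Fin n ↦ μ) := by
  have := Integrable.fintype_prod_dep (μ := fun _ : Fin n ↦ μ)
    (f := fun i x ↦ if i ∈ S then g i x else 1) fun i ↦ by
      by_cases hi : i ∈ S
      · simpa [hi] using hg i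
      · simp [hi]
  refine this.congr (.of_forall fun w ↦ ?_)
  simp

/-- Each edge probability is at most `(b / n) |w i| |w j|`; regrouping by vertices leaves one
truncated moment per vertex, of order its degree. -/
theorem real_lightEdges_le {b : ℝ} (hb : 0 ≤ b) (L : ℝ) {S : Finset (Fin n)}
    {E : Finset (Pairs n)} (hE : E ⊆ pairsIn S) :
    (seedMeasure μ n).real (lightEdges b n L S E) ≤
      (b / n) ^ E.card * ∏ i ∈ S, truncMoment μ L (pairDegree E i) := by
  have h := seedMeasure_real_weights_inter_edges μ (n := n) b
    (measurableSet_forall_mem S (measurableSet_abs_le L)) E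
  refine h.le.trans ?_
  simp only [truncMoment]
  rw [← integral_pi_prod μ S fun i x ↦
    {x | |x| ≤ L}.indicator (fun x ↦ |x| ^ pairDegree E i) x, ← integral_const_mul]
  refine integral_mono_of_nonneg (.of_forall fun w ↦ ?_)
    ((integrable_pi_prod μ S fun i ↦ integrable_truncMoment μ L _).const_mul _)
    (.of_forall fun w ↦ ?_)
  · exact mul_nonneg (Set.indicator_nonneg (by simp) _)
      (Finset.prod_nonneg fun e _ ↦ (edgeProb _ _ _ _).2.1)
  · simp only
    rw [← indicator_forall_mem_mul_prod S _ (pairDegree E) (fun x ↦ |x|) w,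
      ← prod_pairs_eq hE fun i ↦ |w i|, mul_left_comm, ← Finset.prod_const,
      ← Finset.prod_mul_distrib]
    refine mul_le_mul_of_nonneg_left (Finset.prod_le_prod (fun e _ ↦ (edgeProb _ _ _ _).2.1)
      fun e _ ↦ edgeProb_le hb n _ _) (Set.indicator_nonneg (by simp) _)

/-- Counterpart of the upper bound: restricting the weights to `[0, K]` makes the linear lower bound
on edge probabilities available. Here `K` may be far below `L`. -/
theorem le_real_lightEdges {b : ℝ} (hb : 0 ≤ b) {K L : ℝ} (hKL : K ≤ L)
    {S : Finset (Fin n)} {E : Finset (Pairs n)} (hE : E ⊆ pairsIn S) :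
    (b / n / (1 + b / n * K ^ 2)) ^ E.card *
        ∏ i ∈ S, ∫ x, (Set.Icc 0 K).indicator (fun x ↦ x ^ pairDegree E i) x ∂μ ≤
      (seedMeasure μ n).real (lightEdges b n L S E) := by
  have h := seedMeasure_real_weights_inter_edges μ (n := n) b
    (measurableSet_forall_mem S (measurableSet_abs_le L)) E
  refine le_of_le_of_eq ?_ h.symm
  rw [← integral_pi_prod μ S fun i x ↦
    (Set.Icc 0 K).indicator (fun x ↦ x ^ pairDegree E i) x, ← integral_const_mul]
  refine integral_mono_of_nonneg (.of_forall fun w ↦ ?_) ?_ (.of_forall fun w ↦ ?_)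
  · exact mul_nonneg (by positivity) (Finset.prod_nonneg fun i _ ↦
      Set.indicator_nonneg (fun x hx ↦ pow_nonneg hx.1 _) _)
  · refine Integrable.of_bound (C := 1) ?_ (.of_forall fun w ↦ ?_)
    · exact ((measurable_one.indicator (measurableSet_forall_mem S (measurableSet_abs_le L))).mul
        (Finset.measurable_prod _ fun e _ ↦
          measurable_coe_edgeProb b n e.1.1 e.1.2)).aestronglyMeasurable
    · have h1 : 0 ≤ ∏ e ∈ E, (edgeProb b n (w e.1.1) (w e.1.2) : ℝ) :=
        Finset.prod_nonneg fun e _ ↦ (edgeProb _ _ _ _).2.1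
      have h2 : ∏ e ∈ E, (edgeProb b n (w e.1.1) (w e.1.2) : ℝ) ≤ 1 :=
        Finset.prod_le_one (fun e _ ↦ (edgeProb _ _ _ _).2.1) fun e _ ↦ (edgeProb _ _ _ _).2.2
      have h3 : 0 ≤ {w : Fin n → ℝ | ∀ i ∈ S, w i ∈ {x | |x| ≤ L}}.indicator
          (1 : (Fin n → ℝ) → ℝ) w :=
        Set.indicator_nonneg (by simp) _
      have h4 : {w : Fin n → ℝ | ∀ i ∈ S, w i ∈ {x | |x| ≤ L}}.indicator
          (1 : (Fin n → ℝ) → ℝ) w ≤ 1 :=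
        Set.indicator_le_self' (f := 1) (by simp) w
      rw [Real.norm_of_nonneg (mul_nonneg h3 h1)]
      exact mul_le_one₀ h4 h1 h2
  · simp only
    rw [← indicator_forall_mem_mul_prod S _ (pairDegree E) (fun x ↦ x) w,
      ← prod_pairs_eq hE fun i ↦ w i, mul_left_comm, ← Finset.prod_const,
      ← Finset.prod_mul_distrib]
    by_cases hw : ∀ i ∈ S, w i ∈ Set.Icc 0 K
    · have hw' : ∀ i ∈ S, w i ∈ {x | |x| ≤ L} := fun i hi ↦ by
        simpa [abs_of_nonneg (hw i hi).1] using (hw i hi).2.trans hKL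
      rw [Set.indicator_of_mem (by exact hw), Set.indicator_of_mem (by exact hw'), Pi.one_apply,
        one_mul, one_mul]
      refine Finset.prod_le_prod (fun e he ↦ ?_) fun e he ↦ ?_ <;>
      · have h1 := hw _ (mem_pairsIn.1 (hE he)).1
        have h2 := hw _ (mem_pairsIn.1 (hE he)).2
        first
        | exact le_edgeProb hb n h1.1 h2.1 h1.2 h2.2
        | have := h1.1
          have := h2.1
          positivity
    · rw [Set.indicator_of_notMem (by exact hw), zero_mul]
      exact mul_nonneg (Set.indicator_nonneg (by simp) _)
        (Finset.prod_nonneg fun e _ ↦ (edgeProb _ _ _ _).2.1)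

/-! ### Counting vertices by weight; uncorrelated functions of disjoint coordinates -/

open Classical in
/-- The set of vertices whose weight lies in `A`. -/
noncomputable def vertsIn (A : Set ℝ) (w : Fin n → ℝ) : Finset (Fin n) :=
  Finset.univ.filter fun i ↦ w i ∈ A

theorem mem_vertsIn {A : Set ℝ} {w : Fin n → ℝ} {i : Fin n} : i ∈ vertsIn A w ↔ w i ∈ A := by
  simp [vertsIn]

theorem card_vertsIn (A : Set ℝ) (w : Fin n → ℝ) :
    ((vertsIn A w).card : ℝ) = ∑ i, A.indicator 1 (w i) := by
  classical
  simp [vertsIn, Set.indicator_apply]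

theorem measurable_card_vertsIn {A : Set ℝ} (hA : MeasurableSet A) :
    Measurable fun w : Fin n → ℝ ↦ ((vertsIn A w).card : ℝ) := by
  simp_rw [card_vertsIn]
  exact Finset.measurable_sum _ fun i _ ↦ (measurable_one.indicator hA).comp (measurable_pi_apply i)

theorem integral_card_vertsIn {A : Set ℝ} (hA : MeasurableSet A) :
    ∫ w, ((vertsIn A w).card : ℝ) ∂Measure.pi (fun _ : Fin n ↦ μ) = n * μ.real A := by
  simp_rw [card_vertsIn]
  have h : ∀ i : Fin n, ∫ w : Fin n → ℝ, A.indicator (1 : ℝ → ℝ) (w i)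
      ∂Measure.pi (fun _ : Fin n ↦ μ) = μ.real A := fun i ↦ by
    have := integral_pi_prod μ {i} fun _ ↦ A.indicator 1
    simpa [integral_indicator_one hA] using this
  rw [integral_finsetSum _ fun i _ ↦ ?_]
  · simp [h]
  · have := integrable_pi_prod μ (n := n) {i} (g := fun _ ↦ A.indicator 1)
      fun _ ↦ (integrable_const 1).indicator hA
    simpa using this

/-- Chebyshev for a sum of independent indicators, whose variance is at most its mean. -/
theorem real_abs_card_vertsIn_sub_ge_le {A : Set ℝ} (hA : MeasurableSet A) {t : ℝ} (ht : 0 < t) :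
    (Measure.pi fun _ : Fin n ↦ μ).real
      {w | t ≤ |((vertsIn A w).card : ℝ) - n * μ.real A|} ≤ n * μ.real A / t ^ 2 := by
  have hm : MemLp (A.indicator (1 : ℝ → ℝ)) 2 μ := (memLp_const 1).indicator hA
  have hsum : (fun w : Fin n → ℝ ↦ ((vertsIn A w).card : ℝ)) =
      ∑ i, fun w : Fin n → ℝ ↦ A.indicator (1 : ℝ → ℝ) (w i) := by
    ext w; simp [card_vertsIn]
  have hmem : MemLp (fun w : Fin n → ℝ ↦ ((vertsIn A w).card : ℝ)) 2
      (Measure.pi fun _ : Fin n ↦ μ) := by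
    rw [hsum]
    exact memLp_finsetSum' _ fun i _ ↦ hm.comp_measurePreserving (measurePreserving_eval _ i)
  have hvar : variance (fun w : Fin n → ℝ ↦ ((vertsIn A w).card : ℝ))
      (Measure.pi fun _ : Fin n ↦ μ) ≤ n * μ.real A := by
    rw [hsum, variance_sum_pi fun _ ↦ hm, Finset.sum_const, Finset.card_univ, Fintype.card_fin,
      nsmul_eq_mul]
    gcongr
    refine (variance_le_expectation_sq hm.aestronglyMeasurable).trans (le_of_eq ?_)
    rw [← integral_indicator_one hA]
    congr 1 with x
    by_cases hx : x ∈ A <;> simp [hx]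
  have h := meas_ge_le_variance_div_sq hmem ht
  rw [integral_card_vertsIn μ hA] at h
  refine (ENNReal.toReal_mono ENNReal.ofReal_ne_top h).trans ?_
  rw [ENNReal.toReal_ofReal (div_nonneg (variance_nonneg _ _) (by positivity))]
  gcongr

/-- Functions of disjoint sets of coordinates are uncorrelated. -/
theorem integral_mul_of_dependsOn {f g : (Fin n ⊕ Pairs n → ℝ) → ℝ} (hf : Measurable f)
    (hg : Measurable g) {I : Finset (Fin n ⊕ Pairs n)} (hfI : DependsOn f I)
    (hgI : DependsOn g (I : Set (Fin n ⊕ Pairs n))ᶜ) :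
    ∫ ω, f ω * g ω ∂seedMeasure μ n =
      (∫ ω, f ω ∂seedMeasure μ n) * ∫ ω, g ω ∂seedMeasure μ n := by
  classical
  have hcoord : iIndepFun (fun i (ω : Fin n ⊕ Pairs n → ℝ) ↦ ω i) (seedMeasure μ n) :=
    iIndepFun_pi (X := fun _ x ↦ x) fun _ ↦ aemeasurable_id
  have hind := hcoord.indepFun_finset I Iᶜ disjoint_compl_right fun i ↦ measurable_pi_apply i
  have hext : ∀ J : Finset (Fin n ⊕ Pairs n), Measurable fun (y : J → ℝ) (i : Fin n ⊕ Pairs n) ↦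
      if h : i ∈ J then y ⟨i, h⟩ else 0 := fun J ↦ measurable_pi_lambda _ fun i ↦ by
    by_cases h : i ∈ J
    · simpa [h] using measurable_pi_apply _
    · simp [h]
  have hind2 := hind.comp (hf.comp (hext I)) (hg.comp (hext Iᶜ))
  have e1 : (f ∘ fun (y : I → ℝ) i ↦ if h : i ∈ I then y ⟨i, h⟩ else 0) ∘
      (fun ω (i : I) ↦ ω i) = f := by
    ext ω
    exact hfI fun i hi ↦ by simp [Finset.mem_coe.1 hi]
  have e2 : (g ∘ fun (y : (Iᶜ : Finset _) → ℝ) i ↦ if h : i ∈ Iᶜ then y ⟨i, h⟩ else 0) ∘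
      (fun ω (i : (Iᶜ : Finset _)) ↦ ω i) = g := by
    ext ω
    exact hgI fun i hi ↦ by
      have : i ∉ I := by simpa using hi
      simp [this]
  rw [e1, e2] at hind2
  exact hind2.integral_fun_mul_eq_mul_integral hf.aestronglyMeasurable hg.aestronglyMeasurable

end

/-- The union bound over all vertex sets of a given size. -/
theorem real_exists_card_eq_le (μ : Measure ℝ) {n k : ℕ}
    {s : Finset (Fin n) → Set (Fin n ⊕ Pairs n → ℝ)} {c : ℝ}
    (hc : 0 ≤ c) (h : ∀ S : Finset (Fin n), S.card = k → (seedMeasure μ n).real (s S) ≤ c) :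
    (seedMeasure μ n).real {ω | ∃ S : Finset (Fin n), S.card = k ∧ ω ∈ s S} ≤ n ^ k * c := by
  have e : {ω | ∃ S : Finset (Fin n), S.card = k ∧ ω ∈ s S} =
      ⋃ S ∈ Finset.powersetCard k (Finset.univ : Finset (Fin n)), s S := by
    ext ω; simp [Finset.mem_powersetCard]
  rw [e]
  refine (measureReal_biUnion_finset_le _ _).trans ?_
  refine (Finset.sum_le_card_nsmul _ _ c fun S hS ↦ h S (Finset.mem_powersetCard.1 hS).2).trans ?_
  rw [Finset.card_powersetCard, Finset.card_univ, Fintype.card_fin, nsmul_eq_mul]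
  gcongr
  exact_mod_cast Nat.choose_le_pow n k

/-! ### Truncated moments under a power tail -/

section
variable {μ : Measure ℝ} {a α x₀ : ℝ}

/-- Nonnegativity holds only almost surely, so light vertices are defined through the absolute
value; this transfers the tail hypothesis to it. -/
theorem real_lt_abs (hμ : ∀ᵐ x ∂μ, 0 ≤ x)
    (htail : ∀ x : ℝ, x₀ ≤ x → μ.real (Set.Ioi x) = a * x ^ (-α)) {L : ℝ} (hL : x₀ ≤ L) :
    μ.real {x | L < |x|} = a * L ^ (-α) := by
  rw [← htail L hL]
  refine measureReal_congr ?_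
  filter_upwards [hμ] with x hx
  exact propext (show L < |x| ↔ L < x by rw [abs_of_nonneg hx])

variable [IsProbabilityMeasure μ]

/-- Layer cake for `min |x| L`: in the integral of `3 t² P(min |W| L > t)`, the integrand is at most
`3 x₀²` below `x₀`, at most `3 a` between `x₀` and `L` since `t²` cancels the tail, and zero beyond.
-/
theorem truncMoment_three_le (hμ : ∀ᵐ x ∂μ, 0 ≤ x) (ha : 0 ≤ a) (hx₀ : 0 < x₀)
    (htail : ∀ x : ℝ, x₀ ≤ x → μ.real (Set.Ioi x) = a * x ^ (-2 : ℝ)) {L : ℝ} (hL : x₀ ≤ L) :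
    truncMoment μ L 3 ≤ 3 * (x₀ ^ 3 + a * L) := by
  have hL0 : 0 < L := hx₀.trans_le hL
  set f : ℝ → ℝ := fun x ↦ min |x| L with hf
  have hf0 : ∀ x, 0 ≤ f x := fun x ↦ le_min (abs_nonneg x) hL0.le
  have hfL : ∀ x, f x ≤ L := fun x ↦ min_le_right _ _
  have hfm : Measurable f := by fun_prop
  have h1 := lintegral_rpow_eq_lintegral_meas_lt_mul μ (f := f) (.of_forall hf0)
    hfm.aemeasurable (p := 3) (by norm_num)
  have h2 : ∫⁻ t in Set.Ioi (0 : ℝ), μ {x | t < f x} * ENNReal.ofReal (t ^ ((3 : ℝ) - 1)) ≤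
      ∫⁻ t in Set.Ioi (0 : ℝ), ((Set.Ioc 0 x₀).indicator (fun _ ↦ ENNReal.ofReal (x₀ ^ 2)) t +
        (Set.Ioc 0 L).indicator (fun _ ↦ ENNReal.ofReal a) t) := by
    refine setLIntegral_mono ?_ fun t ht ↦ ?_
    · exact ((measurable_const.indicator measurableSet_Ioc).add
        (measurable_const.indicator measurableSet_Ioc))
    have ht : 0 < t := ht
    rw [show (3 : ℝ) - 1 = (2 : ℕ) by norm_num, Real.rpow_natCast]
    rcases le_or_gt t x₀ with h | h
    · rw [Set.indicator_of_mem (show t ∈ Set.Ioc 0 x₀ from ⟨ht, h⟩)]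
      refine le_add_right ?_
      calc _ ≤ 1 * ENNReal.ofReal (x₀ ^ 2) := by
            gcongr
            exact prob_le_one
        _ = _ := one_mul _
    · rcases le_or_gt t L with h' | h'
      · rw [Set.indicator_of_mem (show t ∈ Set.Ioc 0 L from ⟨ht, h'⟩)]
        refine le_add_left ?_
        calc _ ≤ ENNReal.ofReal (a * t ^ (-2 : ℝ)) * ENNReal.ofReal (t ^ 2) := by
              gcongr
              rw [← real_lt_abs hμ htail h.le, ofReal_measureReal]
              exact measure_mono fun x (hx : t < f x) ↦ hx.trans_le (min_le_left _ _)
          _ = ENNReal.ofReal a := by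
              rw [← ENNReal.ofReal_mul (by positivity), mul_assoc]
              congr 1
              rw [Real.rpow_neg ht.le, Real.rpow_two]
              field_simp
      · have : {x | t < f x} = ∅ := by
          ext x
          simpa using (hfL x).trans h'.le
        simp [this]
  have h3 : ∫⁻ t in Set.Ioi (0 : ℝ), ((Set.Ioc 0 x₀).indicator
      (fun _ ↦ ENNReal.ofReal (x₀ ^ 2)) t + (Set.Ioc 0 L).indicator (fun _ ↦ ENNReal.ofReal a) t) ≤
      ENNReal.ofReal (x₀ ^ 3 + a * L) := by
    refine (setLIntegral_le_lintegral _ _).trans ?_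
    rw [lintegral_add_left (measurable_const.indicator measurableSet_Ioc),
      lintegral_indicator_const measurableSet_Ioc, lintegral_indicator_const measurableSet_Ioc,
      Real.volume_Ioc, Real.volume_Ioc, sub_zero, sub_zero,
      ← ENNReal.ofReal_mul (by positivity), ← ENNReal.ofReal_mul ha,
      ← ENNReal.ofReal_add (by positivity) (by positivity)]
    apply le_of_eq
    ring_nf
  have hm3 : AEStronglyMeasurable (fun x ↦ f x ^ (3 : ℝ)) μ :=
    (hfm.pow_const 3).aestronglyMeasurable
  have h4 : truncMoment μ L 3 ≤ ∫ x, f x ^ (3 : ℝ) ∂μ := by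
    refine integral_mono (integrable_truncMoment μ L 3) ?_ fun x ↦ ?_
    · refine Integrable.of_bound (C := L ^ (3 : ℝ)) hm3 (.of_forall fun x ↦ ?_)
      have := hf0 x
      rw [Real.norm_of_nonneg (by positivity)]
      gcongr
      exact hfL x
    · rw [show (3 : ℝ) = (3 : ℕ) by norm_num, Real.rpow_natCast]
      by_cases hx : |x| ≤ L
      · rw [Set.indicator_of_mem (by exact hx), hf]
        simp [hx]
      · rw [Set.indicator_of_notMem (by exact hx)]
        exact pow_nonneg (hf0 x) 3
  refine h4.trans ?_
  rw [integral_eq_lintegral_of_nonneg_ae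
    (.of_forall fun x ↦ Real.rpow_nonneg (hf0 x) _) hm3, h1]
  refine ENNReal.toReal_le_of_le_ofReal (by positivity) ?_
  rw [ENNReal.ofReal_mul (by norm_num)]
  gcongr
  exact h2.trans h3

theorem integrable_sq_of_tail (hμ : ∀ᵐ x ∂μ, 0 ≤ x) (ha : 0 ≤ a) (hα : 2 < α) (hx₀ : 0 < x₀)
    (htail : ∀ x : ℝ, x₀ ≤ x → μ.real (Set.Ioi x) = a * x ^ (-α)) :
    Integrable (fun x ↦ x ^ 2) μ := by
  refine ⟨by fun_prop, ?_⟩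
  rw [hasFiniteIntegral_iff_ofReal (.of_forall fun x ↦ sq_nonneg x)]
  have h1 := lintegral_rpow_eq_lintegral_meas_lt_mul μ (f := fun x ↦ |x|)
    (.of_forall fun x ↦ abs_nonneg x) (by fun_prop) (p := 2) (by norm_num)
  simp only [Real.rpow_two, sq_abs] at h1
  rw [h1]
  refine ENNReal.mul_lt_top ENNReal.ofReal_lt_top ?_
  have hint : IntegrableOn (fun t : ℝ ↦ a * t ^ (1 - α)) (Set.Ioi x₀) :=
    (integrableOn_Ioi_rpow_of_lt (by linarith) hx₀).const_mul a
  have hfin : ∫⁻ t in Set.Ioi x₀, ENNReal.ofReal (a * t ^ (1 - α)) < ⊤ :=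
    hint.lintegral_lt_top
  have hfin2 : ∫⁻ _ in Set.Ioc (0 : ℝ) x₀, ENNReal.ofReal x₀ < ⊤ := by
    rw [setLIntegral_const]
    exact ENNReal.mul_lt_top ENNReal.ofReal_lt_top (by simp)
  rw [← Set.Ioc_union_Ioi_eq_Ioi hx₀.le]
  refine (lintegral_union_le _ _ _).trans_lt (ENNReal.add_lt_top.2 ⟨?_, ?_⟩)
  · refine (setLIntegral_mono measurable_const fun t ht ↦ ?_).trans_lt hfin2
    calc _ ≤ 1 * ENNReal.ofReal x₀ := by
          gcongr
          · exact prob_le_one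
          · norm_num
            exact ht.2
      _ = _ := one_mul _
  · refine (setLIntegral_mono (by fun_prop) fun t ht ↦ ?_).trans_lt hfin
    have ht : x₀ < t := ht
    have ht0 := hx₀.trans ht
    rw [← ofReal_measureReal, real_lt_abs hμ htail ht.le, ← ENNReal.ofReal_mul (by positivity),
      mul_assoc, ← Real.rpow_add ht0]
    apply le_of_eq
    congr 3
    ring

omit [IsProbabilityMeasure μ] in
theorem integral_sq_pos (ha : 0 < a) (hx₀ : 0 < x₀)
    (htail : ∀ x : ℝ, x₀ ≤ x → μ.real (Set.Ioi x) = a * x ^ (-α))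
    (hint : Integrable (fun x ↦ x ^ 2) μ) : 0 < ∫ x, x ^ 2 ∂μ := by
  rw [integral_pos_iff_support_of_nonneg (fun x ↦ sq_nonneg x) hint]
  have h : 0 < μ.real (Set.Ioi x₀) := by rw [htail x₀ le_rfl]; positivity
  refine lt_of_lt_of_le (ENNReal.toReal_pos_iff.1 h).1 (measure_mono fun x hx ↦ ?_)
  have : x₀ < x := hx
  simp [(hx₀.trans this).ne']

omit [IsProbabilityMeasure μ] in
theorem truncMoment_two_le (hint : Integrable (fun x ↦ x ^ 2) μ) (L : ℝ) :
    truncMoment μ L 2 ≤ ∫ x, x ^ 2 ∂μ := by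
  refine integral_mono_of_nonneg
    (.of_forall fun x ↦ Set.indicator_nonneg (fun _ _ ↦ by positivity) x) hint
    (.of_forall fun x ↦ ?_)
  refine (Set.indicator_le_self' (fun x _ ↦ by positivity) x).trans ?_
  simp

omit [IsProbabilityMeasure μ] in
theorem tendsto_integral_Icc_sq (hμ : ∀ᵐ x ∂μ, 0 ≤ x) (hint : Integrable (fun x ↦ x ^ 2) μ) :
    Tendsto (fun K ↦ ∫ x, (Set.Icc 0 K).indicator (fun x ↦ x ^ 2) x ∂μ) atTop
      (𝓝 (∫ x, x ^ 2 ∂μ)) := by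
  refine tendsto_integral_filter_of_dominated_convergence (fun x ↦ x ^ 2)
    (.of_forall fun K ↦ ((by fun_prop : Measurable fun x : ℝ ↦ x ^ 2).indicator
      measurableSet_Icc).aestronglyMeasurable) (.of_forall fun K ↦ .of_forall fun x ↦ ?_) hint ?_
  · rw [Real.norm_of_nonneg (Set.indicator_nonneg (fun x _ ↦ sq_nonneg x) x)]
    exact Set.indicator_le_self' (fun x _ ↦ sq_nonneg x) x
  · filter_upwards [hμ] with x hx
    refine tendsto_const_nhds.congr' ?_
    filter_upwards [eventually_ge_atTop x] with K hK
    rw [Set.indicator_of_mem (show x ∈ Set.Icc 0 K from ⟨hx, hK⟩)]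

-- On `|x| ≤ L` the integrand `|x| ^ (2 + k) / L ^ k` is at most `x ^ 2` and tends to zero
-- pointwise. This replaces the possibly infinite higher moments.
omit [IsProbabilityMeasure μ] in
theorem tendsto_truncMoment_div (hint : Integrable (fun x ↦ x ^ 2) μ) {k : ℕ} (hk : k ≠ 0) :
    Tendsto (fun L ↦ truncMoment μ L (2 + k) / L ^ k) atTop (𝓝 0) := by
  have h : Tendsto (fun L : ℝ ↦ ∫ x, {x | |x| ≤ L}.indicator (fun x ↦ |x| ^ (2 + k)) x / L ^ k ∂μ)
      atTop (𝓝 (∫ _, (0 : ℝ) ∂μ)) := by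
    refine tendsto_integral_filter_of_dominated_convergence (fun x ↦ x ^ 2)
      (.of_forall fun L ↦ (((by fun_prop : Measurable fun x : ℝ ↦ |x| ^ (2 + k)).indicator
        (measurableSet_abs_le L)).div_const _).aestronglyMeasurable) ?_ hint
      (.of_forall fun x ↦ ?_)
    · filter_upwards [eventually_gt_atTop 0] with L hL
      refine .of_forall fun x ↦ ?_
      by_cases hx : |x| ≤ L
      · rw [Set.indicator_of_mem (by exact hx), Real.norm_of_nonneg (by positivity), pow_add,
          sq_abs, div_le_iff₀ (by positivity)]
        gcongr
      · rw [Set.indicator_of_notMem (by exact hx)]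
        simp [sq_nonneg]
    · have h2 : Tendsto (fun L : ℝ ↦ |x| ^ (2 + k) / L ^ k) atTop (𝓝 0) :=
        (tendsto_pow_atTop hk).const_div_atTop _
      refine h2.congr' ?_
      filter_upwards [eventually_ge_atTop |x|] with L hL
      rw [Set.indicator_of_mem (by exact hL)]
  simpa [truncMoment, integral_div] using h

end

/-! ### Light cliques and heavy vertices; the case α = 2 -/

section
variable {μ : Measure ℝ} [IsProbabilityMeasure μ] {a b α x₀ : ℝ}

theorem measurableSet_lt_abs (L : ℝ) : MeasurableSet {x : ℝ | L < |x|} :=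
  measurableSet_lt measurable_const measurable_id.abs

theorem measurableSet_seedGraph_mem (b : ℝ) (n : ℕ) (s : Set (SimpleGraph (Fin n))) :
    MeasurableSet {ω | seedGraph b n ω ∈ s} :=
  measurable_seedGraph b n (measurableSet_simpleGraph s)

/-- A 4-clique has six edges and all degrees three, and there are at most `n ^ 4` candidate vertex
sets. -/
theorem real_lightClique_four_le (hb : 0 ≤ b) (n : ℕ) (L : ℝ) :
    (seedMeasure μ n).real {ω | ∃ S : Finset (Fin n), S.card = 4 ∧
      ω ∈ lightEdges b n L S (pairsIn S)} ≤ n ^ 4 * ((b / n) ^ 6 * truncMoment μ L 3 ^ 4) := by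
  refine real_exists_card_eq_le μ (mul_nonneg (by positivity)
    (pow_nonneg (truncMoment_nonneg μ L 3) 4)) fun S hS ↦ ?_
  have hc := two_mul_card_pairsIn S
  rw [hS] at hc
  have hc : (pairsIn S).card = 6 := by omega
  refine (real_lightEdges_le μ hb L (Finset.Subset.refl _)).trans (le_of_eq ?_)
  rw [hc, Finset.prod_congr rfl fun i hi ↦ by rw [pairDegree_pairsIn hi, hS],
    Finset.prod_const, hS]

/-- Without light cliques on `k` vertices, the clique number exceeds the number of heavy vertices
by less than `k`. -/
theorem cliqueNum_lt_of_no_lightClique {n k : ℕ} {L : ℝ} {ω : Fin n ⊕ Pairs n → ℝ}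
    (h : ¬ ∃ S : Finset (Fin n), S.card = k ∧ ω ∈ lightEdges b n L S (pairsIn S)) :
    (seedGraph b n ω).cliqueNum <
      k + (vertsIn {x | L < |x|} fun i ↦ ω (.inl i)).card := by
  by_contra! hcon
  obtain ⟨S, hS, hcl⟩ := le_cliqueNum_iff.1 le_rfl
  rw [← hS] at hcon
  have hk : k ≤ (S \ vertsIn {x | L < |x|} fun i ↦ ω (.inl i)).card := by
    have := Finset.le_card_sdiff (vertsIn {x | L < |x|} fun i ↦ ω (.inl i)) S
    omega
  obtain ⟨T, hT, hTk⟩ := Finset.exists_subset_card_eq hk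
  refine h ⟨T, hTk, fun i hi ↦ ?_, ?_⟩
  · have := (Finset.mem_sdiff.1 (hT hi)).2
    rw [mem_vertsIn] at this
    exact not_lt.1 this
  · exact seedGraph_isClique.1 (hcl.subset (Finset.coe_subset.2
      (hT.trans Finset.sdiff_subset)))

theorem real_card_vertsIn_ge_le {n : ℕ} {A : Set ℝ} (hA : MeasurableSet A) {t : ℝ} (ht : 0 < t) :
    (seedMeasure μ n).real {ω | n * μ.real A + t ≤ ((vertsIn A fun i ↦ ω (.inl i)).card : ℝ)} ≤
      n * μ.real A / t ^ 2 := by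
  have hm : MeasurableSet {w : Fin n → ℝ | n * μ.real A + t ≤ ((vertsIn A w).card : ℝ)} :=
    measurableSet_le measurable_const (measurable_card_vertsIn hA)
  refine (seedMeasure_real_weights μ hm).le.trans
    (le_trans (measureReal_mono fun w hw ↦ ?_) (real_abs_card_vertsIn_sub_ge_le μ hA ht))
  have hw : n * μ.real A + t ≤ ((vertsIn A w).card : ℝ) := hw
  show t ≤ |_|
  exact le_abs.2 (.inl (by linarith))

theorem real_card_vertsIn_le_le {n : ℕ} {A : Set ℝ} (hA : MeasurableSet A) {t : ℝ} (ht : 0 < t) :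
    (Measure.pi fun _ : Fin n ↦ μ).real {w | ((vertsIn A w).card : ℝ) ≤ n * μ.real A - t} ≤
      n * μ.real A / t ^ 2 := by
  refine le_trans (measureReal_mono fun w hw ↦ ?_) (real_abs_card_vertsIn_sub_ge_le μ hA ht)
  have hw : ((vertsIn A w).card : ℝ) ≤ n * μ.real A - t := hw
  show t ≤ |_|
  exact le_abs.2 (.inr (by linarith))

theorem isBigOpOne_cliqueNum (hμ : ∀ᵐ x ∂μ, 0 ≤ x) (ha : 0 < a) (hb : 0 < b) (hx₀ : 0 < x₀)
    (htail : ∀ x : ℝ, x₀ ≤ x → μ.real (Set.Ioi x) = a * x ^ (-2 : ℝ)) :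
    IsBigOpOne (graphLaw μ b) (fun _ G ↦ (G.cliqueNum : ℝ)) := by
  intro ε hε
  -- With `L = η √n` and third moment at most `6 a L`, all powers of `n` in `n⁴ (b / n)⁶ (6 a L)⁴`
  -- cancel, leaving this quantity.
  obtain ⟨η, hη0, hη⟩ : ∃ η : ℝ, 0 < η ∧ b ^ 6 * (6 * (a * η)) ^ 4 < ε / 2 := by
    have hc : Tendsto (fun η : ℝ ↦ b ^ 6 * (6 * (a * η)) ^ 4) (𝓝[>] 0) (𝓝 0) := by
      have : Continuous fun η : ℝ ↦ b ^ 6 * (6 * (a * η)) ^ 4 := by fun_prop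
      simpa using (this.tendsto 0).mono_left nhdsWithin_le_nhds
    obtain ⟨η, h1, h2⟩ := ((hc.eventually_lt_const (half_pos hε)).and self_mem_nhdsWithin).exists
    exact ⟨η, h2, h1⟩
  have hlim : Tendsto (fun n : ℕ ↦ η * √(n : ℝ)) atTop atTop :=
    (Real.tendsto_sqrt_atTop.comp tendsto_natCast_atTop_atTop).const_mul_atTop hη0
  -- Beyond `n₀` the tail formula applies at `L`, and `a L ≥ x₀³` absorbs the constant in the
  -- third-moment bound, whence the factor `6`.
  obtain ⟨n₀, hn₀⟩ := eventually_atTop.1 ((hlim.eventually_ge_atTop x₀).and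
    (((hlim.const_mul_atTop ha).eventually_ge_atTop (x₀ ^ 3)).and (eventually_ge_atTop 1)))
  obtain ⟨t, ht0, ht⟩ : ∃ t : ℝ, 0 < t ∧ a / η ^ 2 / t ^ 2 ≤ ε / 2 := by
    have hc : Tendsto (fun t : ℝ ↦ a / η ^ 2 / t ^ 2) atTop (𝓝 0) :=
      (tendsto_pow_atTop two_ne_zero).const_div_atTop _
    obtain ⟨t, h1, h2⟩ := ((hc.eventually_lt_const (half_pos hε)).and
      (eventually_gt_atTop 0)).exists
    exact ⟨t, h2, h1.le⟩
  -- For `n < n₀` the clique number is at most `n`, so `n₀` suffices; otherwise `4` pays for light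
  -- vertices and `a / η² + t` for the mean number of heavy ones plus a deviation.
  refine ⟨max n₀ (4 + (a / η ^ 2 + t)), fun n ↦ ?_⟩
  rcases lt_or_ge n n₀ with hn | hn
  · have : {G : SimpleGraph (Fin n) | max (n₀ : ℝ) (4 + (a / η ^ 2 + t)) < |(G.cliqueNum : ℝ)|} =
        ∅ := by
      ext G
      simp only [Set.mem_ofPred_eq, Set.mem_empty_iff_false, iff_false, not_lt, Nat.abs_cast]
      obtain ⟨S, hS⟩ := G.exists_isNClique_cliqueNum
      have h1 : G.cliqueNum ≤ n := by
        rw [← hS.card_eq]; simpa using Finset.card_le_univ S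
      exact (Nat.cast_le.2 (h1.trans hn.le)).trans (le_max_left _ _)
    rw [this]
    simpa using hε.le
  obtain ⟨h1, h2, h3⟩ := hn₀ n hn
  set L := η * √(n : ℝ) with hL
  have hn0 : (0 : ℝ) < n := by exact_mod_cast h3
  have hL2 : L ^ 2 = η ^ 2 * n := by rw [hL, mul_pow, Real.sq_sqrt hn0.le]
  have hq : n * μ.real {x | L < |x|} = a / η ^ 2 := by
    rw [real_lt_abs hμ htail h1, Real.rpow_neg (hx₀.le.trans h1), Real.rpow_two, hL2]
    field_simp
  rw [graphLaw_real]
  have hsub : {ω | seedGraph b n ω ∈ {G | max (n₀ : ℝ) (4 + (a / η ^ 2 + t)) <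
      |(G.cliqueNum : ℝ)|}} ⊆ {ω | ∃ S : Finset (Fin n), S.card = 4 ∧
      ω ∈ lightEdges b n L S (pairsIn S)} ∪ {ω | n * μ.real {x | L < |x|} + t ≤
        ((vertsIn {x | L < |x|} fun i ↦ ω (.inl i)).card : ℝ)} := by
    intro ω hω
    simp only [Set.mem_ofPred_eq, Nat.abs_cast] at hω
    by_contra hcon
    rw [Set.mem_union, not_or] at hcon
    have h4 := cliqueNum_lt_of_no_lightClique hcon.1
    have h5 := not_le.1 (show ¬ n * μ.real {x | L < |x|} + t ≤
      ((vertsIn {x | L < |x|} fun i ↦ ω (.inl i)).card : ℝ) from hcon.2)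
    rw [hq] at h5
    have h6 : ((seedGraph b n ω).cliqueNum : ℝ) <
      4 + (vertsIn {x | L < |x|} fun i ↦ ω (.inl i)).card := by exact_mod_cast h4
    have h7 := (le_max_right _ _).trans_lt hω
    linarith
  refine (measureReal_mono hsub).trans ((measureReal_union_le _ _).trans ?_)
  have h8 := (real_card_vertsIn_ge_le (μ := μ) (n := n) (measurableSet_lt_abs L) ht0).trans_eq
    (congrArg (· / t ^ 2) hq)
  have h9 : (seedMeasure μ n).real {ω | ∃ S : Finset (Fin n), S.card = 4 ∧
      ω ∈ lightEdges b n L S (pairsIn S)} ≤ b ^ 6 * (6 * (a * η)) ^ 4 := by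
    refine (real_lightClique_four_le hb.le n L).trans ?_
    have h10 : truncMoment μ L 3 ≤ 6 * (a * L) := by
      have := truncMoment_three_le hμ ha.le hx₀ htail h1
      linarith
    calc _ ≤ (n : ℝ) ^ 4 * ((b / n) ^ 6 * (6 * (a * L)) ^ 4) := by
          gcongr
          exact truncMoment_nonneg μ L 3
      _ = (n : ℝ) ^ 4 * ((b / n) ^ 6 * (6 * a) ^ 4 * (L ^ 2) ^ 2) := by ring
      _ = b ^ 6 * (6 * (a * η)) ^ 4 := by
          rw [hL2]; field_simp
  linarith

theorem real_forall_lt_edgeProb (n : ℕ) (b : ℝ) (w : Fin n → ℝ) (E : Finset (Pairs n)) :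
    (Measure.pi fun _ : Pairs n ↦ unifMeasure).real
      {u | ∀ e ∈ E, u e < edgeProb b n (w e.1.1) (w e.1.2)} =
        ∏ e ∈ E, (edgeProb b n (w e.1.1) (w e.1.2) : ℝ) := by
  have := pi_real_forall_mem unifMeasure E fun e ↦
    Set.Iio (edgeProb b n (w e.1.1) (w e.1.2) : ℝ)
  simp only [unifMeasure_real_Iio] at this
  exact this

theorem real_forall_edgeProb_le (n : ℕ) (b : ℝ) (w : Fin n → ℝ) (E : Finset (Pairs n)) :
    (Measure.pi fun _ : Pairs n ↦ unifMeasure).real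
      {u | ∀ e ∈ E, (edgeProb b n (w e.1.1) (w e.1.2) : ℝ) ≤ u e} =
        ∏ e ∈ E, (1 - (edgeProb b n (w e.1.1) (w e.1.2) : ℝ)) := by
  have := pi_real_forall_mem unifMeasure E fun e ↦
    Set.Ici (edgeProb b n (w e.1.1) (w e.1.2) : ℝ)
  simp only [unifMeasure_real_Ici] at this
  exact this

theorem not_whp_cliqueNum_le (ha : 0 < a) (hb : 0 < b) (hx₀ : 0 < x₀)
    (htail : ∀ x : ℝ, x₀ ≤ x → μ.real (Set.Ioi x) = a * x ^ (-2 : ℝ)) :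
    ¬ ∃ C : ℝ, Whp (graphLaw μ b) (fun _ ↦ {G | (G.cliqueNum : ℝ) ≤ C}) := by
  rintro ⟨C, hC⟩
  obtain ⟨k, hk1, hkC⟩ : ∃ k : ℕ, 1 ≤ k ∧ C < k := by
    obtain ⟨k, hk⟩ := exists_nat_gt C
    exact ⟨k + 1, by omega, by push_cast; linarith⟩
  have hk0 : (1 : ℝ) ≤ k := by exact_mod_cast hk1
  -- The level `s √n` is tuned so that the mean number of heavy vertices is `4 k`.
  obtain ⟨s, hs0, hs⟩ : ∃ s : ℝ, 0 < s ∧ a / s ^ 2 = 4 * k := by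
    refine ⟨√(a / (4 * k)), by positivity, ?_⟩
    rw [Real.sq_sqrt (by positivity)]
    field_simp
  set p := 1 - Real.exp (-(b * s ^ 2)) with hp
  have hp0 : 0 < p := by
    have : Real.exp (-(b * s ^ 2)) < 1 := Real.exp_lt_one_iff.2 (by
      rw [neg_lt_zero]; positivity)
    linarith
  have hp1 : p ≤ 1 := by linarith [Real.exp_pos (-(b * s ^ 2))]
  -- A lower bound for the conditional probability that `k` given heavy vertices form a clique; `k *
  -- k` generously bounds the number of pairs.
  set r := p ^ (k * k) with hr
  have hr0 : 0 < r := pow_pos hp0 _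
  have hlim : Tendsto (fun n : ℕ ↦ s * √(n : ℝ)) atTop atTop :=
    (Real.tendsto_sqrt_atTop.comp tendsto_natCast_atTop_atTop).const_mul_atTop hs0
  have hev : ∀ᶠ n : ℕ in atTop,
      (graphLaw μ b n).real {G | (G.cliqueNum : ℝ) ≤ C} ≤ 1 - r * (5 / 9) := by
    filter_upwards [hlim.eventually_ge_atTop x₀, eventually_ge_atTop 1] with n h1 h3
    set L := s * √(n : ℝ) with hL
    have hL0 : 0 < L := hx₀.trans_le h1
    have hn0 : (0 : ℝ) < n := by exact_mod_cast h3
    have hL2 : L ^ 2 = s ^ 2 * n := by rw [hL, mul_pow, Real.sq_sqrt hn0.le]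
    have hq : n * μ.real (Set.Ioi L) = 4 * k := by
      rw [← hs, htail L h1, Real.rpow_neg hL0.le, Real.rpow_two, hL2]
      field_simp
    set B := {w : Fin n → ℝ | (k : ℝ) < ((vertsIn (Set.Ioi L) w).card : ℝ)} with hB
    have hBm : MeasurableSet B :=
      measurableSet_lt measurable_const (measurable_card_vertsIn measurableSet_Ioi)
    -- A drop of `3 k` below the mean `4 k` has probability at most `4 k / (3 k)² ≤ 4 / 9`, as `k ≥
    -- 1`.
    have hBc : (Measure.pi fun _ : Fin n ↦ μ).real Bᶜ ≤ 4 / 9 := by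
      have h4 := real_card_vertsIn_le_le (μ := μ) (n := n) (measurableSet_Ioi (a := L))
        (t := 3 * k) (by positivity)
      rw [hq] at h4
      refine (measureReal_mono fun w hw ↦ ?_).trans (h4.trans ?_)
      · have hw : ¬ ((k : ℝ) < ((vertsIn (Set.Ioi L) w).card : ℝ)) := hw
        show ((vertsIn (Set.Ioi L) w).card : ℝ) ≤ _
        linarith
      · rw [div_le_iff₀ (by positivity)]
        nlinarith
    rw [graphLaw_real]
    have hcond := seedMeasure_real_le_of_conditional μ (c := 1 - r)
      (measurableSet_seedGraph_mem b n {G | (G.cliqueNum : ℝ) ≤ C}) hBm fun w hw ↦ ?_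
    · rw [probReal_compl_eq_one_sub hBm] at hcond hBc
      nlinarith
    · have hw : k ≤ (vertsIn (Set.Ioi L) w).card := by
        have : (k : ℝ) < ((vertsIn (Set.Ioi L) w).card : ℝ) := hw
        exact_mod_cast this.le
      obtain ⟨S, hS, hSk⟩ := Finset.exists_subset_card_eq hw
      have hprod : r ≤ ∏ e ∈ pairsIn S, (edgeProb b n (w e.1.1) (w e.1.2) : ℝ) := by
        have hcard : (pairsIn S).card ≤ k * k := by
          have := two_mul_card_pairsIn S
          rw [hSk] at this
          nlinarith [Nat.sub_le k 1]
        calc r ≤ p ^ (pairsIn S).card := pow_le_pow_of_le_one hp0.le hp1 hcard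
          _ ≤ _ := by
            rw [← Finset.prod_const]
            refine Finset.prod_le_prod (fun _ _ ↦ hp0.le) fun e he ↦ ?_
            rw [mem_pairsIn] at he
            have e1 : L < w e.1.1 := mem_vertsIn.1 (hS he.1)
            have e2 : L < w e.1.2 := mem_vertsIn.1 (hS he.2)
            have := one_sub_exp_le_edgeProb hb.le n (x := w e.1.1) (y := w e.1.2) (t := L ^ 2)
              (by nlinarith) (by positivity)
            rwa [hL2, mul_div_assoc, mul_div_cancel_right₀ _ hn0.ne'] at this
      rw [← real_forall_lt_edgeProb n b w (pairsIn S)] at hprod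
      have hm : MeasurableSet {u : Pairs n → ℝ |
          ∀ e ∈ pairsIn S, u e < edgeProb b n (w e.1.1) (w e.1.2)} := by
        simp only [Set.ofPred_forall]
        exact Finset.measurableSet_biInter _ fun e _ ↦
          measurableSet_lt (measurable_pi_apply e) measurable_const
      have h5 := probReal_compl_eq_one_sub (μ := Measure.pi fun _ : Pairs n ↦ unifMeasure) hm
      refine (measureReal_mono (fun u hu hu' ↦ ?_)).trans (h5.le.trans (by linarith))
      have hu : ((seedGraph b n (Sum.elim w u)).cliqueNum : ℝ) ≤ C := hu
      have hcl : k ≤ (seedGraph b n (Sum.elim w u)).cliqueNum :=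
        le_cliqueNum_iff.2 ⟨S, hSk, seedGraph_isClique.2 hu'⟩
      have : (k : ℝ) ≤ (seedGraph b n (Sum.elim w u)).cliqueNum := by exact_mod_cast hcl
      linarith
  -- The limit would give `1 ≤ 1 - 5 r / 9`, although `r > 0`.
  have := le_of_tendsto hC hev
  nlinarith

end

/-! ### Poisson approximation for light triangles -/

/-- The vertex sets of potential triangles. -/
abbrev Triple (n : ℕ) : Type := {S : Finset (Fin n) // S.card = 3}

/-- A triangle on `S` whose vertices all have weight at most `L`. -/
def lightTriangle (b : ℝ) (n : ℕ) (L : ℝ) (S : Triple n) : Set (Fin n ⊕ Pairs n → ℝ) :=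
  lightEdges b n L S.1 (pairsIn S.1)

/-- Choose the union of `k` vertices, then two of its subsets. -/
theorem card_pairs_union_le (n k : ℕ) :
    ((Finset.univ.filter fun p : Triple n × Triple n ↦ (p.1.1 ∪ p.2.1).card = k).card : ℝ) ≤
      n ^ k * 4 ^ k := by
  have h : (Finset.univ.filter fun p : Triple n × Triple n ↦ (p.1.1 ∪ p.2.1).card = k).card ≤
      ((Finset.powersetCard k (Finset.univ : Finset (Fin n))).biUnion
        fun U ↦ U.powerset ×ˢ U.powerset).card := by
    refine Finset.card_le_card_of_injOn (fun p ↦ (p.1.1, p.2.1)) (fun p hp ↦ ?_) ?_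
    · have hp : (p.1.1 ∪ p.2.1).card = k := by simpa using hp
      rw [Finset.mem_coe, Finset.mem_biUnion]
      exact ⟨p.1.1 ∪ p.2.1, by simp [Finset.mem_powersetCard, hp], Finset.mem_product.2
        ⟨Finset.mem_powerset.2 Finset.subset_union_left,
          Finset.mem_powerset.2 Finset.subset_union_right⟩⟩
    · rintro ⟨p, p'⟩ _ ⟨q, q'⟩ _ hpq
      simp only [Prod.mk.injEq] at hpq
      rw [Subtype.ext hpq.1, Subtype.ext hpq.2]
  have h2 := h.trans Finset.card_biUnion_le
  rw [Finset.sum_congr rfl fun U hU ↦ by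
    rw [Finset.card_product, Finset.card_powerset, (Finset.mem_powersetCard.1 hU).2],
    Finset.sum_const, Finset.card_powersetCard, Finset.card_univ, Fintype.card_fin,
    smul_eq_mul, ← mul_pow] at h2
  have h3 := h2.trans (Nat.mul_le_mul_right _ (Nat.choose_le_pow n k))
  exact_mod_cast h3

/-- A sum over pairs of triples is estimated according to the size of their union. -/
theorem sum_intersecting_le {n : ℕ} {f : Triple n → Triple n → ℝ} {c : ℕ → ℝ} {K : Finset ℕ}
    (R : Triple n → Finset (Triple n))
    (hc : ∀ S, ∀ T ∈ R S, (S.1 ∪ T.1).card ∈ K ∧ f S T ≤ c (S.1 ∪ T.1).card)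
    (hc0 : ∀ k, 0 ≤ c k) :
    ∑ S, ∑ T ∈ R S, f S T ≤ ∑ k ∈ K, n ^ k * 4 ^ k * c k := by
  have h1 : ∑ S, ∑ T ∈ R S, f S T ≤ ∑ S : Triple n, ∑ T : Triple n,
      ∑ k ∈ K, if (S.1 ∪ T.1).card = k then c k else 0 := by
    refine Finset.sum_le_sum fun S _ ↦ ?_
    refine (Finset.sum_le_sum fun T hT ↦ ?_).trans
      (Finset.sum_le_univ_sum_of_nonneg fun T ↦ Finset.sum_nonneg fun k _ ↦ ?_)
    · rw [Finset.sum_ite_eq, if_pos (hc S T hT).1]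
      exact (hc S T hT).2
    · split_ifs
      exacts [hc0 k, le_rfl]
  refine h1.trans (le_of_eq_of_le ?_ (Finset.sum_le_sum fun k _ ↦
    mul_le_mul_of_nonneg_right (card_pairs_union_le n k) (hc0 k)))
  rw [← Fintype.sum_prod_type' (f := fun S T : Triple n ↦
    ∑ k ∈ K, if (S.1 ∪ T.1).card = k then c k else 0), Finset.sum_comm]
  refine Finset.sum_congr rfl fun k _ ↦ ?_
  rw [← Finset.sum_filter, Finset.sum_const, nsmul_eq_mul]

theorem lightEdges_inter (b : ℝ) (n : ℕ) (L : ℝ) (S T : Finset (Fin n)) (E F : Finset (Pairs n)) :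
    lightEdges b n L S E ∩ lightEdges b n L T F = lightEdges b n L (S ∪ T) (E ∪ F) := by
  ext ω
  simp only [lightEdges, Set.mem_inter_iff, Set.mem_ofPred_eq, Finset.mem_union]
  grind

theorem lightEdges_iff_of_eqOn {b : ℝ} {n : ℕ} {L : ℝ} {S : Finset (Fin n)}
    {ω ω' : Fin n ⊕ Pairs n → ℝ} (h1 : ∀ i ∈ S, ω (.inl i) = ω' (.inl i))
    (h2 : ∀ e ∈ pairsIn S, ω (.inr e) = ω' (.inr e)) :
    ω ∈ lightEdges b n L S (pairsIn S) ↔ ω' ∈ lightEdges b n L S (pairsIn S) := by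
  refine and_congr (forall₂_congr fun i hi ↦ by rw [h1 i hi]) (forall₂_congr fun e he ↦ ?_)
  have := mem_pairsIn.1 he
  rw [SeedEdge, SeedEdge, h2 e he, h1 _ this.1, h1 _ this.2]

section
variable (μ : Measure ℝ) [IsProbabilityMeasure μ] {b : ℝ}

/-- In the union of two triangles sharing `j` vertices, each shared vertex has degree `2 + 2 - (j -
1)`, and each of the `6 - 2 j` others has degree two. -/
theorem real_lightTriangle_inter_le (hb : 0 ≤ b) {n : ℕ} (L : ℝ) {S T : Triple n} {j : ℕ}
    (hj : (S.1 ∩ T.1).card = j) :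
    (seedMeasure μ n).real (lightTriangle b n L S ∩ lightTriangle b n L T) ≤
      (b / n) ^ (pairsIn S.1 ∪ pairsIn T.1).card *
        (truncMoment μ L (4 - (j - 1)) ^ j * truncMoment μ L 2 ^ (6 - 2 * j)) := by
  rw [lightTriangle, lightTriangle, lightEdges_inter]
  have hE : pairsIn S.1 ∪ pairsIn T.1 ⊆ pairsIn (S.1 ∪ T.1) :=
    Finset.union_subset (pairsIn_mono Finset.subset_union_left)
      (pairsIn_mono Finset.subset_union_right)
  refine (real_lightEdges_le μ hb L hE).trans (le_of_eq ?_)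
  congr 1
  have hI : S.1 ∩ T.1 ⊆ S.1 ∪ T.1 := Finset.inter_subset_union
  have hS := S.2
  have hT := T.2
  rw [← Finset.prod_sdiff hI, mul_comm]
  have hdeg := fun i ↦ pairDegree_union_add_inter (pairsIn S.1) (pairsIn T.1) i
  simp_rw [← pairsIn_inter] at hdeg
  congr 1
  · rw [← hj]
    refine Finset.prod_eq_pow_card fun i hi ↦ ?_
    have hd := hdeg i
    rw [pairDegree_pairsIn hi, pairDegree_pairsIn (Finset.mem_inter.1 hi).1,
      pairDegree_pairsIn (Finset.mem_inter.1 hi).2] at hd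
    congr 1
    omega
  · have hc : ((S.1 ∪ T.1) \ (S.1 ∩ T.1)).card = 6 - 2 * j := by
      have := Finset.card_union_add_card_inter S.1 T.1
      rw [Finset.card_sdiff_of_subset hI]
      omega
    rw [← hc]
    refine Finset.prod_eq_pow_card fun i hi ↦ ?_
    have hd := hdeg i
    rw [Finset.mem_sdiff] at hi
    rw [pairDegree_pairsIn_of_notMem hi.2] at hd
    rcases Finset.mem_union.1 hi.1 with h | h
    · have h' : i ∉ T.1 := fun h' ↦ hi.2 (Finset.mem_inter.2 ⟨h, h'⟩)
      rw [pairDegree_pairsIn h, pairDegree_pairsIn_of_notMem h'] at hd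
      congr 1
      omega
    · have h' : i ∉ S.1 := fun h' ↦ hi.2 (Finset.mem_inter.2 ⟨h', h⟩)
      rw [pairDegree_pairsIn h, pairDegree_pairsIn_of_notMem h'] at hd
      congr 1
      omega

theorem card_pairs_union_add {n : ℕ} (S T : Triple n) {j : ℕ} (hj : (S.1 ∩ T.1).card = j) :
    2 * (pairsIn S.1 ∪ pairsIn T.1).card + j * (j - 1) = 12 := by
  have h1 := two_mul_card_pairsIn S.1
  have h2 := two_mul_card_pairsIn T.1
  have h3 := two_mul_card_pairsIn (S.1 ∩ T.1)
  have h4 := Finset.card_union_add_card_inter (pairsIn S.1) (pairsIn T.1)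
  rw [← pairsIn_inter] at h4
  rw [S.2] at h1
  rw [T.2] at h2
  rw [hj] at h3
  omega

theorem real_lightTriangle_le (hb : 0 ≤ b) {n : ℕ} (L : ℝ) (S : Triple n) :
    (seedMeasure μ n).real (lightTriangle b n L S) ≤ (b / n * truncMoment μ L 2) ^ 3 := by
  have hc := two_mul_card_pairsIn S.1
  rw [S.2] at hc
  refine (real_lightEdges_le μ hb L (Finset.Subset.refl _)).trans (le_of_eq ?_)
  rw [Finset.prod_congr rfl fun i hi ↦ by rw [pairDegree_pairsIn hi, S.2],
    Finset.prod_const, S.2, mul_pow]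
  congr 2
  omega

theorem le_real_lightTriangle (hb : 0 ≤ b) {n : ℕ} {K L : ℝ} (hKL : K ≤ L)
    (S : Triple n) : (b / n / (1 + b / n * K ^ 2) *
      ∫ x, (Set.Icc 0 K).indicator (fun x ↦ x ^ 2) x ∂μ) ^ 3 ≤
      (seedMeasure μ n).real (lightTriangle b n L S) := by
  have hc := two_mul_card_pairsIn S.1
  rw [S.2] at hc
  have hc : (pairsIn S.1).card = 3 := by omega
  refine le_of_eq_of_le ?_ (le_real_lightEdges μ hb hKL (Finset.Subset.refl _))
  rw [Finset.prod_congr rfl fun i hi ↦ by rw [pairDegree_pairsIn hi, S.2],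
    Finset.prod_const, S.2, mul_pow, hc]

theorem measurableSet_lightTriangle (b : ℝ) (n : ℕ) (L : ℝ) (S : Triple n) :
    MeasurableSet (lightTriangle b n L S) := measurableSet_lightEdges b n L _ _

/-- Vertex-disjoint triangles use disjoint weights and disjoint uniforms, so the dependency
neighbourhood of `S` consists of the triples meeting it. -/
theorem abs_real_no_lightTriangle_sub_le (b : ℝ) (n : ℕ) (L : ℝ) :
    |(seedMeasure μ n).real {ω | ∀ S, ω ∉ lightTriangle b n L S} -
        Real.exp (-∑ S, (seedMeasure μ n).real (lightTriangle b n L S))| ≤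
      ∑ S : Triple n, ∑ T ∈ Finset.univ.filter (fun T : Triple n ↦ ¬ Disjoint S.1 T.1),
          (seedMeasure μ n).real (lightTriangle b n L S) *
            (seedMeasure μ n).real (lightTriangle b n L T) +
        ∑ S : Triple n,
          ∑ T ∈ (Finset.univ.filter (fun T : Triple n ↦ ¬ Disjoint S.1 T.1)).erase S,
            (seedMeasure μ n).real (lightTriangle b n L S ∩ lightTriangle b n L T) := by
  refine abs_real_forall_notMem_sub_exp_le (seedMeasure μ n)
    (measurableSet_lightTriangle b n L) (fun S ↦ ?_) fun S s ↦ ?_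
  · have : S.1 ≠ ∅ := by
      intro h
      have := S.2
      simp [h] at this
    simpa using this
  · rw [← integral_indicator_one (measurableSet_lightTriangle b n L S)]
    -- Assigning a pair to `I` by its first endpoint alone is enough: it captures every pair inside
    -- `S` and no pair inside a set disjoint from `S`.
    set I : Finset (Fin n ⊕ Pairs n) := Finset.univ.filter fun i ↦
      Sum.elim id (fun e ↦ e.1.1) i ∈ S.1 with hI
    refine integral_mul_of_dependsOn μ (I := I)
      (measurable_one.indicator (measurableSet_lightTriangle b n L S))
      (Finset.measurable_prod _ fun T _ ↦ measurable_const.sub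
        ((measurable_one.indicator (measurableSet_lightTriangle b n L T)).const_mul s)) ?_ ?_
    · intro ω ω' h
      have h1 : ω ∈ lightTriangle b n L S ↔ ω' ∈ lightTriangle b n L S :=
        lightEdges_iff_of_eqOn (fun i hi ↦ h _ (by simp [hI, hi]))
          (fun e he ↦ h _ (by simp [hI, (mem_pairsIn.1 he).1]))
      by_cases h2 : ω ∈ lightTriangle b n L S
      · rw [Set.indicator_of_mem h2, Set.indicator_of_mem (h1.1 h2)]; rfl
      · rw [Set.indicator_of_notMem h2, Set.indicator_of_notMem (fun h3 ↦ h2 (h1.2 h3))]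
    · intro ω ω' h
      refine Finset.prod_congr rfl fun T hT ↦ ?_
      have hd : Disjoint S.1 T.1 := by simpa using hT
      have hd' := Finset.disjoint_right.1 hd
      have h1 : ω ∈ lightTriangle b n L T ↔ ω' ∈ lightTriangle b n L T :=
        lightEdges_iff_of_eqOn (fun i hi ↦ h _ (by simp [hI, hd' hi]))
          (fun e he ↦ h _ (by simp [hI, hd' (mem_pairsIn.1 he).1]))
      by_cases h2 : ω ∈ lightTriangle b n L T
      · rw [Set.indicator_of_mem h2, Set.indicator_of_mem (h1.1 h2)]; rfl
      · rw [Set.indicator_of_notMem h2, Set.indicator_of_notMem (fun h3 ↦ h2 (h1.2 h3))]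

theorem abs_real_no_lightTriangle_sub_le_moments (hb : 0 ≤ b) (n : ℕ) (L : ℝ) :
    |(seedMeasure μ n).real {ω | ∀ S, ω ∉ lightTriangle b n L S} -
        Real.exp (-∑ S, (seedMeasure μ n).real (lightTriangle b n L S))| ≤
      ∑ k ∈ {3, 4, 5}, (n : ℝ) ^ k * 4 ^ k * ((b / n * truncMoment μ L 2) ^ 3) ^ 2 +
        ((n : ℝ) ^ 4 * 4 ^ 4 *
            ((b / n) ^ 5 * (truncMoment μ L 3 ^ 2 * truncMoment μ L 2 ^ 2)) +
          (n : ℝ) ^ 5 * 4 ^ 5 * ((b / n) ^ 6 * (truncMoment μ L 4 * truncMoment μ L 2 ^ 4))) := by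
  have m2 := truncMoment_nonneg μ L 2
  have m3 := truncMoment_nonneg μ L 3
  have m4 := truncMoment_nonneg μ L 4
  have hP := real_lightTriangle_le μ hb L (n := n)
  have hcard : ∀ S T : Triple n, ¬ Disjoint S.1 T.1 → 1 ≤ (S.1 ∩ T.1).card := fun S T h ↦ by
    rw [Nat.one_le_iff_ne_zero, Finset.card_ne_zero]
    exact Finset.not_disjoint_iff_nonempty_inter.1 h
  have hle : ∀ S T : Triple n, (S.1 ∩ T.1).card ≤ 3 := fun S T ↦
    (Finset.card_le_card Finset.inter_subset_left).trans_eq S.2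
  have hun : ∀ S T : Triple n, (S.1 ∪ T.1).card + (S.1 ∩ T.1).card = 6 := fun S T ↦ by
    rw [Finset.card_union_add_card_inter, S.2, T.2]
  refine (abs_real_no_lightTriangle_sub_le μ b n L).trans (add_le_add ?_ ?_)
  · refine sum_intersecting_le (c := fun _ ↦ ((b / n * truncMoment μ L 2) ^ 3) ^ 2)
      _ (fun S T hT ↦ ?_)
      fun _ ↦ by positivity
    have h1 := hcard S T (by simpa using hT)
    have h2 := hun S T
    have h3 := hle S T
    refine ⟨by simp; omega, ?_⟩
    rw [sq]
    exact mul_le_mul (hP S) (hP T) measureReal_nonneg (by positivity)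
  -- Distinct intersecting triangles share an edge (four vertices, five edges, degrees 3, 3, 2, 2)
  -- or just a vertex (five vertices, six edges, degrees 4, 2, 2, 2, 2).
  · have h := sum_intersecting_le (n := n) (K := {4, 5}) (c := fun k ↦ if k = 4 then
        (b / n) ^ 5 * (truncMoment μ L 3 ^ 2 * truncMoment μ L 2 ^ 2) else
        (b / n) ^ 6 * (truncMoment μ L 4 * truncMoment μ L 2 ^ 4))
      (f := fun S T ↦ (seedMeasure μ n).real (lightTriangle b n L S ∩ lightTriangle b n L T))
      (fun S ↦ (Finset.univ.filter (fun T : Triple n ↦ ¬ Disjoint S.1 T.1)).erase S)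
      (fun S T hT ↦ ?_) fun k ↦ by split_ifs <;> positivity
    · simpa using h
    · rw [Finset.mem_erase, Finset.mem_filter] at hT
      have h1 := hcard S T hT.2.2
      have h2 := hun S T
      have h3 := hle S T
      have h4 : (S.1 ∩ T.1).card ≠ 3 := by
        intro h
        refine hT.1 (Subtype.ext ?_)
        have e1 := Finset.eq_of_subset_of_card_le (Finset.inter_subset_left (s₁ := S.1) (s₂ := T.1))
          (by rw [h, S.2])
        have e2 := Finset.eq_of_subset_of_card_le (Finset.inter_subset_right (s₁ := S.1)
          (s₂ := T.1)) (by rw [h, T.2])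
        rw [← e2, e1]
      have h5 : (S.1 ∩ T.1).card = 1 ∨ (S.1 ∩ T.1).card = 2 := by omega
      rcases h5 with h5 | h5
      · have h6 := card_pairs_union_add S T h5
        have h7 : (pairsIn S.1 ∪ pairsIn T.1).card = 6 := by omega
        have h8 : (S.1 ∪ T.1).card = 5 := by omega
        have h9 := real_lightTriangle_inter_le μ hb L h5
        rw [h7] at h9
        rw [h8]
        exact ⟨by simp, by simpa using h9⟩
      · have h6 := card_pairs_union_add S T h5
        have h7 : (pairsIn S.1 ∪ pairsIn T.1).card = 5 := by omega
        have h8 : (S.1 ∪ T.1).card = 4 := by omega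
        have h9 := real_lightTriangle_inter_le μ hb L h5
        rw [h7] at h9
        rw [h8]
        exact ⟨by simp, by simpa using h9⟩

end

/-! ### Limits in the case α > 2 -/

section
variable {μ : Measure ℝ} [IsProbabilityMeasure μ] {a b α x₀ : ℝ}

theorem tendsto_sqrt_natCast : Tendsto (fun n : ℕ ↦ √(n : ℝ)) atTop atTop :=
  Real.tendsto_sqrt_atTop.comp tendsto_natCast_atTop_atTop

theorem tendsto_sum_real_lightTriangle (hμ : ∀ᵐ x ∂μ, 0 ≤ x) (hb : 0 < b)
    (hint : Integrable (fun x ↦ x ^ 2) μ) :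
    Tendsto (fun n : ℕ ↦ ∑ S, (seedMeasure μ n).real (lightTriangle b n (√n) S)) atTop
      (𝓝 (1 / 6 * (b * ∫ x, x ^ 2 ∂μ) ^ 3)) := by
  set M := ∫ x, x ^ 2 ∂μ with hM
  have hcard : ∀ n : ℕ, ((Finset.univ : Finset (Triple n)).card : ℝ) = n.choose 3 := fun n ↦ by
    rw [Finset.card_univ, Fintype.card_finset_len, Fintype.card_fin]
  have hlim : ∀ p : ℕ → ℝ, Tendsto (fun n : ℕ ↦ n * p n) atTop (𝓝 (b * M)) →
      Tendsto (fun n : ℕ ↦ (n.choose 3 : ℝ) * p n ^ 3) atTop (𝓝 (1 / 6 * (b * M) ^ 3)) := by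
    intro p hp
    have := tendsto_choose_mul_pow_atTop 3 hp
    rwa [show (b * M) ^ 3 / (Nat.factorial 3 : ℝ) = 1 / 6 * (b * M) ^ 3 by
      rw [show Nat.factorial 3 = 6 from rfl]; push_cast; ring] at this
  have hup : Tendsto (fun n : ℕ ↦ (n : ℝ) * (b / n * M)) atTop (𝓝 (b * M)) := by
    refine tendsto_const_nhds.congr' ?_
    filter_upwards [eventually_ge_atTop 1] with n hn
    have : (n : ℝ) ≠ 0 := by positivity
    field_simp
  -- The lower truncation is `K = n^(1/4)`: it tends to infinity, so the second moment is recovered,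
  -- while `b K² / n = b / √n` vanishes.
  have hlow : Tendsto (fun n : ℕ ↦ (n : ℝ) * (b / n / (1 + b / n * √(√(n : ℝ)) ^ 2) *
      ∫ x, (Set.Icc 0 √(√(n : ℝ))).indicator (fun x ↦ x ^ 2) x ∂μ)) atTop (𝓝 (b * M)) := by
    have h1 : Tendsto (fun n : ℕ ↦ b / √(n : ℝ)) atTop (𝓝 0) :=
      tendsto_sqrt_natCast.const_div_atTop b
    have h2 := (tendsto_integral_Icc_sq hμ hint).comp
      (Real.tendsto_sqrt_atTop.comp tendsto_sqrt_natCast)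
    have h3 := ((tendsto_const_nhds (x := b)).div (h1.const_add 1) (by norm_num)).mul h2
    rw [add_zero, div_one] at h3
    refine h3.congr' ?_
    filter_upwards [eventually_ge_atTop 1] with n hn
    have hn0 : (0 : ℝ) < n := by exact_mod_cast hn
    have h4 : b / n * √(√(n : ℝ)) ^ 2 = b / √(n : ℝ) := by
      rw [Real.sq_sqrt (Real.sqrt_nonneg _), div_mul_eq_mul_div, div_eq_div_iff hn0.ne'
        (Real.sqrt_pos.2 hn0).ne', mul_assoc, Real.mul_self_sqrt hn0.le]
    simp only [Function.comp_apply, Pi.div_apply]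
    rw [h4]
    field_simp
  refine tendsto_of_tendsto_of_tendsto_of_le_of_le' (hlim _ hlow) (hlim _ hup) ?_ ?_
  · filter_upwards [eventually_ge_atTop 1] with n hn
    rw [← hcard, ← nsmul_eq_mul]
    refine Finset.card_nsmul_le_sum _ _ _ fun S _ ↦ le_real_lightTriangle μ hb.le ?_ S
    have h1 : (1 : ℝ) ≤ √(n : ℝ) := Real.one_le_sqrt.2 (by exact_mod_cast hn)
    exact (Real.sqrt_le_sqrt (by nlinarith [Real.sq_sqrt (Nat.cast_nonneg (α := ℝ) n)] :
      √(n : ℝ) ≤ √(n : ℝ) ^ 2)).trans_eq (Real.sqrt_sq (Real.sqrt_nonneg _))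
  · refine .of_forall fun n ↦ ?_
    rw [← hcard, ← nsmul_eq_mul]
    refine Finset.sum_le_card_nsmul _ _ _ fun S _ ↦
      (real_lightTriangle_le μ hb.le _ S).trans ?_
    have := truncMoment_nonneg μ (√(n : ℝ)) 2
    gcongr
    exact truncMoment_two_le hint _

theorem tendsto_real_no_lightTriangle (hμ : ∀ᵐ x ∂μ, 0 ≤ x) (hb : 0 < b)
    (hint : Integrable (fun x ↦ x ^ 2) μ) :
    Tendsto (fun n : ℕ ↦ (seedMeasure μ n).real {ω | ∀ S, ω ∉ lightTriangle b n (√n) S}) atTop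
      (𝓝 (Real.exp (-(1 / 6 * (b * ∫ x, x ^ 2 ∂μ) ^ 3)))) := by
  have hmain := (Real.continuous_exp.tendsto _).comp
    (tendsto_sum_real_lightTriangle hμ hb hint).neg
  set M := ∫ x, x ^ 2 ∂μ with hM
  have hM0 : 0 ≤ M := integral_nonneg fun x ↦ sq_nonneg x
  -- The three summands bound the products of probabilities, the triangle pairs sharing an edge, and
  -- those sharing one vertex; the last two have the form of truncated moments that vanish after
  -- normalisation.
  set g : ℕ → ℝ := fun n ↦ 3 * 4 ^ 5 * (b * M) ^ 6 / n +
    (4 ^ 4 * b ^ 5 * M ^ 2 * (truncMoment μ (√n) 3 / √n ^ 1) ^ 2 +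
      4 ^ 5 * b ^ 6 * M ^ 4 * (truncMoment μ (√n) 4 / √n ^ 2)) with hg
  have hg0 : Tendsto g atTop (𝓝 0) := by
    have h1 : Tendsto (fun n : ℕ ↦ 3 * 4 ^ 5 * (b * M) ^ 6 / (n : ℝ)) atTop (𝓝 0) :=
      tendsto_natCast_atTop_atTop.const_div_atTop _
    have h2 := (tendsto_truncMoment_div hint one_ne_zero).comp tendsto_sqrt_natCast
    have h3 := (tendsto_truncMoment_div hint two_ne_zero).comp tendsto_sqrt_natCast
    simpa [hg] using h1.add (((h2.pow 2).const_mul (4 ^ 4 * b ^ 5 * M ^ 2)).add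
      (h3.const_mul (4 ^ 5 * b ^ 6 * M ^ 4)))
  have hdiff : Tendsto (fun n : ℕ ↦
      (seedMeasure μ n).real {ω | ∀ S, ω ∉ lightTriangle b n (√n) S} -
        Real.exp (-∑ S, (seedMeasure μ n).real (lightTriangle b n (√n) S))) atTop (𝓝 0) := by
    refine squeeze_zero_norm' ?_ hg0
    filter_upwards [eventually_ge_atTop 1] with n hn
    have hn1 : (1 : ℝ) ≤ n := by exact_mod_cast hn
    have hn0 : (0 : ℝ) < n := by linarith
    have hs0 := Real.sqrt_pos.2 hn0
    have m2 := truncMoment_nonneg μ (√(n : ℝ)) 2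
    have m2' := truncMoment_two_le hint √(n : ℝ)
    have m3 := truncMoment_nonneg μ (√(n : ℝ)) 3
    have m4 := truncMoment_nonneg μ (√(n : ℝ)) 4
    refine (abs_real_no_lightTriangle_sub_le_moments μ hb.le n √n).trans
      (add_le_add ?_ (add_le_add ?_ ?_))
    · have hk : ∀ k ∈ ({3, 4, 5} : Finset ℕ), (n : ℝ) ^ k * 4 ^ k *
          ((b / n * truncMoment μ (√n) 2) ^ 3) ^ 2 ≤ 4 ^ 5 * (b * M) ^ 6 / n := by
        intro k hk
        have hk : k ≤ 5 := by simp at hk; omega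
        calc _ ≤ (n : ℝ) ^ 5 * 4 ^ 5 * ((b / n * M) ^ 3) ^ 2 := by
              gcongr
              · norm_num
          _ = _ := by field_simp
      refine (Finset.sum_le_card_nsmul _ _ _ hk).trans (le_of_eq ?_)
      simp
      ring
    · calc _ ≤ (n : ℝ) ^ 4 * 4 ^ 4 * ((b / n) ^ 5 * (truncMoment μ (√n) 3 ^ 2 * M ^ 2)) := by
            gcongr
        _ = _ := by
            rw [pow_one, div_pow _ (√(n : ℝ)), Real.sq_sqrt hn0.le]
            field_simp
    · calc _ ≤ (n : ℝ) ^ 5 * 4 ^ 5 * ((b / n) ^ 6 * (truncMoment μ (√n) 4 * M ^ 4)) := by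
            gcongr
        _ = _ := by
            rw [Real.sq_sqrt hn0.le]
            field_simp
  simpa using hdiff.add hmain

theorem tendsto_real_lightClique_four (hb : 0 < b) (hint : Integrable (fun x ↦ x ^ 2) μ) :
    Tendsto (fun n : ℕ ↦ (seedMeasure μ n).real {ω | ∃ S : Finset (Fin n), S.card = 4 ∧
      ω ∈ lightEdges b n (√n) S (pairsIn S)}) atTop (𝓝 0) := by
  have h2 := (tendsto_truncMoment_div hint one_ne_zero).comp tendsto_sqrt_natCast
  have h3 : Tendsto (fun n : ℕ ↦ b ^ 6 * (truncMoment μ (√n) 3 / √n ^ 1) ^ 4) atTop (𝓝 0) := by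
    simpa using (h2.pow 4).const_mul (b ^ 6)
  refine squeeze_zero' (.of_forall fun n ↦ measureReal_nonneg) ?_ h3
  filter_upwards [eventually_ge_atTop 1] with n hn
  have hn0 : (0 : ℝ) < n := by exact_mod_cast hn
  refine (real_lightClique_four_le hb.le n _).trans (le_of_eq ?_)
  have : √(n : ℝ) ^ 4 = n ^ 2 := by
    rw [show √(n : ℝ) ^ 4 = (√(n : ℝ) ^ 2) ^ 2 by ring, Real.sq_sqrt hn0.le]
  rw [pow_one, div_pow _ (√(n : ℝ)), this]
  field_simp

/-- With high probability no vertex has weight above `√n` when `α > 2`. -/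
theorem tendsto_real_exists_heavy (hμ : ∀ᵐ x ∂μ, 0 ≤ x) (hα : 2 < α)
    (htail : ∀ x : ℝ, x₀ ≤ x → μ.real (Set.Ioi x) = a * x ^ (-α)) :
    Tendsto (fun n : ℕ ↦ (seedMeasure μ n).real {ω |
      1 ≤ (vertsIn {x | √(n : ℝ) < |x|} fun i ↦ ω (.inl i)).card}) atTop (𝓝 0) := by
  have hq : Tendsto (fun n : ℕ ↦ n * μ.real {x | √(n : ℝ) < |x|}) atTop (𝓝 0) := by
    have h1 : Tendsto (fun n : ℕ ↦ a * (n : ℝ) ^ (-(α / 2 - 1))) atTop (𝓝 0) := by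
      simpa using ((tendsto_rpow_neg_atTop (y := α / 2 - 1) (by linarith)).comp
        tendsto_natCast_atTop_atTop).const_mul a
    refine h1.congr' ?_
    filter_upwards [tendsto_sqrt_natCast.eventually_ge_atTop x₀, eventually_ge_atTop 1] with n hn h1
    have hn0 : (0 : ℝ) < n := by exact_mod_cast h1
    rw [real_lt_abs hμ htail hn, Real.sqrt_eq_rpow, ← Real.rpow_mul hn0.le, mul_left_comm,
      ← Real.rpow_one_add' hn0.le (by linarith)]
    ring_nf
  have h4 : Tendsto (fun n : ℕ ↦ n * μ.real {x | √(n : ℝ) < |x|} / (1 / 2) ^ 2) atTop (𝓝 0) := by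
    simpa only [zero_div] using hq.div_const ((1 / 2 : ℝ) ^ 2)
  refine squeeze_zero' (.of_forall fun n ↦ measureReal_nonneg) ?_ h4
  filter_upwards [hq.eventually_lt_const (show (0 : ℝ) < 1 / 2 by norm_num)] with n hn
  refine (measureReal_mono fun ω hω ↦ ?_).trans
    (real_card_vertsIn_ge_le (measurableSet_lt_abs _) one_half_pos)
  have hω : 1 ≤ (vertsIn {x | √(n : ℝ) < |x|} fun i ↦ ω (.inl i)).card := hω
  have : (1 : ℝ) ≤ (vertsIn {x | √(n : ℝ) < |x|} fun i ↦ ω (.inl i)).card := by exact_mod_cast hω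
  show n * μ.real {x | √(n : ℝ) < |x|} + 1 / 2 ≤
    ((vertsIn {x | √(n : ℝ) < |x|} fun i ↦ ω (.inl i)).card : ℝ)
  linarith

/-- With high probability the graph has an edge. -/
theorem tendsto_real_cliqueNum_le_one (ha : 0 < a) (hb : 0 < b) (hx₀ : 0 < x₀)
    (htail : ∀ x : ℝ, x₀ ≤ x → μ.real (Set.Ioi x) = a * x ^ (-α)) :
    Tendsto (fun n : ℕ ↦ (seedMeasure μ n).real {ω | (seedGraph b n ω).cliqueNum ≤ 1}) atTop
      (𝓝 0) := by
  set q := μ.real (Set.Ioi x₀) with hq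
  have hq0 : 0 < q := by rw [hq, htail x₀ le_rfl]; positivity
  -- When more than `n q / 2` vertices exceed `x₀`, they span at least `(n q / 2) (n q / 2 - 1) / 2`
  -- pairs, each missing with probability at most `exp (-b x₀² / n)`. One factor `n` cancels, and
  -- `d` collects the constants.
  set d := b * x₀ ^ 2 * (q / 2) with hd
  have hd0 : 0 < d := by positivity
  have hlim : Tendsto (fun n : ℕ ↦ Real.exp (-(d * (n * (q / 2) - 1) / 2)) + 4 / (n * q)) atTop
      (𝓝 (0 + 0)) := by
    refine Tendsto.add ?_ ?_
    · refine Real.tendsto_exp_neg_atTop_nhds_zero.comp ?_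
      refine (Tendsto.const_mul_atTop hd0 ?_).atTop_div_const two_pos
      exact tendsto_atTop_add_const_right _ _
        (tendsto_natCast_atTop_atTop.atTop_mul_const (by positivity))
    · exact (tendsto_natCast_atTop_atTop.atTop_mul_const hq0).const_div_atTop 4
  rw [add_zero] at hlim
  refine squeeze_zero' (.of_forall fun n ↦ measureReal_nonneg) ?_ hlim
  have hbig : ∀ᶠ n : ℕ in atTop, 1 ≤ (n : ℝ) * (q / 2) :=
    (tendsto_natCast_atTop_atTop.atTop_mul_const (by positivity)).eventually_ge_atTop 1
  filter_upwards [eventually_ge_atTop 1, hbig] with n hn hnq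
  have hn0 : (0 : ℝ) < n := by exact_mod_cast hn
  set B := {w : Fin n → ℝ | n * q - n * (q / 2) < ((vertsIn (Set.Ioi x₀) w).card : ℝ)} with hB
  have hBm : MeasurableSet B :=
    measurableSet_lt measurable_const (measurable_card_vertsIn measurableSet_Ioi)
  have hBc : (Measure.pi fun _ : Fin n ↦ μ).real Bᶜ ≤ 4 / (n * q) := by
    refine (measureReal_mono fun w hw ↦ ?_).trans ((real_card_vertsIn_le_le (μ := μ) (n := n)
      (measurableSet_Ioi (a := x₀)) (t := n * (q / 2)) (by positivity)).trans (le_of_eq ?_))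
    · exact not_lt.1 (show ¬ (n * q - n * (q / 2) < ((vertsIn (Set.Ioi x₀) w).card : ℝ)) from hw)
    · rw [← hq]
      field_simp
      norm_num
  have hcond := seedMeasure_real_le_of_conditional μ (c := Real.exp (-(d * (n * (q / 2) - 1) / 2)))
    (s := {ω | (seedGraph b n ω).cliqueNum ≤ 1})
    (measurableSet_seedGraph_mem b n {G | G.cliqueNum ≤ 1}) hBm fun w hw ↦ ?_
  · refine hcond.trans (add_le_add (mul_le_of_le_one_right (Real.exp_pos _).le ?_) hBc)
    exact measureReal_le_one
  · set S := vertsIn (Set.Ioi x₀) w with hS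
    have hw : n * q - n * (q / 2) < (S.card : ℝ) := hw
    refine (measureReal_mono (s₂ := {u | ∀ e ∈ pairsIn S,
      (edgeProb b n (w e.1.1) (w e.1.2) : ℝ) ≤ u e}) (fun u hu e he ↦ ?_)).trans ?_
    · have hu : (seedGraph b n (Sum.elim w u)).cliqueNum ≤ 1 := hu
      by_contra! hlt
      have : 2 ≤ (seedGraph b n (Sum.elim w u)).cliqueNum := by
        refine le_cliqueNum_iff.2 ⟨{e.1.1, e.1.2}, Finset.card_pair e.2.ne, ?_⟩
        have hadj : (seedGraph b n (Sum.elim w u)).Adj e.1.1 e.1.2 := (seedGraph_adj e.2).2 hlt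
        simpa [SimpleGraph.isClique_pair] using fun _ ↦ hadj
      omega
    · rw [real_forall_edgeProb_le]
      have hcard : (n * (q / 2)) * (n * (q / 2) - 1) / 2 ≤ ((pairsIn S).card : ℝ) := by
        have h1 : (2 : ℝ) * (pairsIn S).card = S.card * ((S.card - 1 : ℕ) : ℝ) := by
          exact_mod_cast two_mul_card_pairsIn S
        have hS1 : 1 ≤ S.card := by
          have : (0 : ℝ) < S.card := by nlinarith
          exact_mod_cast this
        rw [Nat.cast_sub hS1, Nat.cast_one] at h1
        nlinarith
      calc _ ≤ ∏ e ∈ pairsIn S, Real.exp (-(b * x₀ ^ 2 / n)) := by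
            refine Finset.prod_le_prod (fun e _ ↦ by linarith [(edgeProb b n (w e.1.1)
              (w e.1.2)).2.2]) fun e he ↦ ?_
            rw [mem_pairsIn] at he
            have e1 : x₀ < w e.1.1 := mem_vertsIn.1 he.1
            have e2 : x₀ < w e.1.2 := mem_vertsIn.1 he.2
            have := one_sub_exp_le_edgeProb hb.le n (x := w e.1.1) (y := w e.1.2) (t := x₀ ^ 2)
              (by nlinarith) (by positivity)
            linarith
        _ = Real.exp (-((pairsIn S).card * (b * x₀ ^ 2 / n))) := by
            rw [Finset.prod_const, ← Real.exp_nat_mul]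
            ring_nf
        _ ≤ _ := by
            gcongr
            calc d * (n * (q / 2) - 1) / 2 =
                (n * (q / 2)) * (n * (q / 2) - 1) / 2 * (b * x₀ ^ 2 / n) := by
                  rw [hd]; field_simp
              _ ≤ _ := by gcongr

theorem whp_cliqueNum_two_or_three (hμ : ∀ᵐ x ∂μ, 0 ≤ x) (ha : 0 < a) (hb : 0 < b)
    (hα : 2 < α) (hx₀ : 0 < x₀)
    (htail : ∀ x : ℝ, x₀ ≤ x → μ.real (Set.Ioi x) = a * x ^ (-α)) :
    Whp (graphLaw μ b) fun _ ↦ {G | G.cliqueNum = 2 ∨ G.cliqueNum = 3} := by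
  have hint := integrable_sq_of_tail hμ ha.le hα hx₀ htail
  have hlim := ((tendsto_real_cliqueNum_le_one ha hb hx₀ htail).add
    ((tendsto_real_lightClique_four hb hint).add
      (tendsto_real_exists_heavy hμ hα htail))).const_sub 1
  simp only [add_zero, sub_zero] at hlim
  refine tendsto_of_tendsto_of_tendsto_of_le_of_le hlim tendsto_const_nhds (fun n ↦ ?_)
    fun n ↦ measureReal_le_one
  simp only
  rw [graphLaw_real, sub_le_iff_le_add, ← sub_le_iff_le_add',
    ← probReal_compl_eq_one_sub (measurableSet_seedGraph_mem b n _)]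
  refine le_trans (measureReal_mono fun ω hω ↦ ?_) ((measureReal_union_le _ _).trans
    (add_le_add le_rfl (measureReal_union_le _ _)))
  by_contra hcon
  simp only [Set.mem_union, not_or] at hcon
  have h1 : ¬ (seedGraph b n ω).cliqueNum ≤ 1 := hcon.1
  have h2 := cliqueNum_lt_of_no_lightClique hcon.2.1
  have h3 : ¬ 1 ≤ (vertsIn {x | √(n : ℝ) < |x|} fun i ↦ ω (.inl i)).card := hcon.2.2
  exact hω (show _ ∨ _ by omega)

theorem tendsto_real_cliqueNum_eq_two (hμ : ∀ᵐ x ∂μ, 0 ≤ x) (ha : 0 < a) (hb : 0 < b)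
    (hα : 2 < α) (hx₀ : 0 < x₀)
    (htail : ∀ x : ℝ, x₀ ≤ x → μ.real (Set.Ioi x) = a * x ^ (-α)) :
    Tendsto (fun n ↦ (graphLaw μ b n).real {G | G.cliqueNum = 2}) atTop
      (𝓝 (Real.exp (-(1 / 6 * (b * ∫ x, x ^ 2 ∂μ) ^ 3)))) := by
  have hint := integrable_sq_of_tail hμ ha.le hα hx₀ htail
  have hT := tendsto_real_no_lightTriangle hμ hb hint
  have hlow := hT.sub ((tendsto_real_cliqueNum_le_one ha hb hx₀ htail).add
    (tendsto_real_exists_heavy hμ hα htail))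
  simp only [add_zero, sub_zero] at hlow
  refine tendsto_of_tendsto_of_tendsto_of_le_of_le hlow hT (fun n ↦ ?_) fun n ↦ ?_
  · simp only
    rw [graphLaw_real, sub_le_iff_le_add]
    refine le_trans (measureReal_mono fun ω hω ↦ ?_) ((measureReal_union_le _ _).trans
      (add_le_add le_rfl (measureReal_union_le _ _)))
    by_contra hcon
    simp only [Set.mem_union, not_or] at hcon
    have h0 : ¬ (seedGraph b n ω).cliqueNum = 2 := hcon.1
    have h1 : ¬ (seedGraph b n ω).cliqueNum ≤ 1 := hcon.2.1
    have h2 := cliqueNum_lt_of_no_lightClique (k := 3) (L := √n) (ω := ω)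
      fun ⟨S, hS, h⟩ ↦ hω ⟨S, hS⟩ h
    have h3 : ¬ 1 ≤ (vertsIn {x | √(n : ℝ) < |x|} fun i ↦ ω (.inl i)).card := hcon.2.2
    omega
  · simp only
    rw [graphLaw_real]
    refine measureReal_mono fun ω hω S hS ↦ ?_
    have hω : (seedGraph b n ω).cliqueNum = 2 := hω
    have : 3 ≤ (seedGraph b n ω).cliqueNum :=
      le_cliqueNum_iff.2 ⟨S.1, S.2, seedGraph_isClique.2 hS.2⟩
    omega

theorem tendsto_real_cliqueNum_eq_three (hμ : ∀ᵐ x ∂μ, 0 ≤ x) (ha : 0 < a) (hb : 0 < b)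
    (hα : 2 < α) (hx₀ : 0 < x₀)
    (htail : ∀ x : ℝ, x₀ ≤ x → μ.real (Set.Ioi x) = a * x ^ (-α)) :
    Tendsto (fun n ↦ (graphLaw μ b n).real {G | G.cliqueNum = 3}) atTop
      (𝓝 (1 - Real.exp (-(1 / 6 * (b * ∫ x, x ^ 2 ∂μ) ^ 3)))) := by
  have h := Tendsto.sub (whp_cliqueNum_two_or_three hμ ha hb hα hx₀ htail)
    (tendsto_real_cliqueNum_eq_two hμ ha hb hα hx₀ htail)
  refine h.congr fun n ↦ ?_
  have hu : {G : SimpleGraph (Fin n) | G.cliqueNum = 2 ∨ G.cliqueNum = 3} =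
      {G | G.cliqueNum = 2} ∪ {G | G.cliqueNum = 3} := rfl
  beta_reduce
  rw [hu, measureReal_union ?_ (measurableSet_simpleGraph _), add_sub_cancel_left]
  refine Set.disjoint_left.2 fun G h1 h2 ↦ ?_
  have h1 : G.cliqueNum = 2 := h1
  have h2 : G.cliqueNum = 3 := h2
  omega

end

/-! ### The case α < 2: the critical level and the order of magnitude -/

/-- The weight above which vertices `i`, `j` are joined with probability at least `1 - n⁻ᴬ`. -/
noncomputable def heavyLevel (b A : ℝ) (n : ℕ) : ℝ := √(A * n * Real.log n / b)

/-- The order of magnitude `n ^ (1 - α / 2) (log n) ^ (-α / 2)` of the clique number. -/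
noncomputable def cliqueScale (α : ℝ) (n : ℕ) : ℝ :=
  (n : ℝ) ^ (1 - α / 2) * Real.log n ^ (-(α / 2))

theorem tendsto_log_natCast : Tendsto (fun n : ℕ ↦ Real.log n) atTop atTop :=
  Real.tendsto_log_atTop.comp tendsto_natCast_atTop_atTop

theorem tendsto_log_rpow_mul_rpow_neg (s : ℝ) {δ : ℝ} (hδ : 0 < δ) :
    Tendsto (fun n : ℕ ↦ Real.log n ^ s * (n : ℝ) ^ (-δ)) atTop (𝓝 0) := by
  have h := ((isLittleO_log_rpow_rpow_atTop s hδ).tendsto_div_nhds_zero).comp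
    tendsto_natCast_atTop_atTop
  refine h.congr fun n ↦ ?_
  simp only [Function.comp_apply]
  rw [Real.rpow_neg (Nat.cast_nonneg n), div_eq_mul_inv]

theorem eventually_log_natCast_pos : ∀ᶠ n : ℕ in atTop, 0 < Real.log n :=
  tendsto_log_natCast.eventually_gt_atTop 0

theorem cliqueScale_pos {α : ℝ} {n : ℕ} (hn : 0 < n) (hl : 0 < Real.log n) :
    0 < cliqueScale α n := by
  unfold cliqueScale; positivity

theorem tendsto_inv_cliqueScale {α : ℝ} (hα : α < 2) :
    Tendsto (fun n ↦ (cliqueScale α n)⁻¹) atTop (𝓝 0) := by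
  refine (tendsto_log_rpow_mul_rpow_neg (α / 2) (show 0 < 1 - α / 2 by linarith)).congr' ?_
  filter_upwards [eventually_log_natCast_pos] with n hl
  rw [cliqueScale, mul_inv, ← Real.rpow_neg (Nat.cast_nonneg n), ← Real.rpow_neg hl.le, neg_neg,
    mul_comm]

theorem tendsto_rpow_mul_log_div_cliqueScale {α A : ℝ} (hA : A < 1 - α / 2) :
    Tendsto (fun n : ℕ ↦ (n : ℝ) ^ A * Real.log n / cliqueScale α n) atTop (𝓝 0) := by
  refine (tendsto_log_rpow_mul_rpow_neg (1 + α / 2) (sub_pos.2 hA)).congr' ?_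
  filter_upwards [eventually_log_natCast_pos, eventually_gt_atTop 0] with n hl hn
  have hn0 : (0 : ℝ) < n := by exact_mod_cast hn
  rw [cliqueScale, Real.rpow_neg hl.le, Real.rpow_add hl, Real.rpow_one, neg_sub,
    Real.rpow_sub hn0]
  field_simp

theorem tendsto_cliqueScale_mul_rpow_neg {α A : ℝ} (hA : 1 - α / 2 < A) :
    Tendsto (fun n : ℕ ↦ cliqueScale α n * (n : ℝ) ^ (-A)) atTop (𝓝 0) := by
  refine (tendsto_log_rpow_mul_rpow_neg (-(α / 2)) (sub_pos.2 hA)).congr' ?_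
  filter_upwards [eventually_gt_atTop 0] with n hn
  have hn0 : (0 : ℝ) < n := by exact_mod_cast hn
  rw [cliqueScale, mul_right_comm, ← Real.rpow_add hn0, mul_comm]
  ring_nf

theorem tendsto_heavyLevel {b A : ℝ} (hb : 0 < b) (hA : 0 < A) :
    Tendsto (heavyLevel b A) atTop atTop := by
  refine Real.tendsto_sqrt_atTop.comp (Tendsto.atTop_div_const hb ?_)
  exact (tendsto_natCast_atTop_atTop.const_mul_atTop hA).atTop_mul_atTop₀ tendsto_log_natCast

theorem sq_heavyLevel {b A : ℝ} {n : ℕ} (hb : 0 < b) (hA : 0 < A) (hl : 0 < Real.log n) :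
    heavyLevel b A n ^ 2 = A * n * Real.log n / b := by
  rw [heavyLevel, Real.sq_sqrt (by positivity)]

theorem exp_heavyLevel {b A : ℝ} {n : ℕ} (hb : 0 < b) (hA : 0 < A) (hn : 0 < n)
    (hl : 0 < Real.log n) :
    Real.exp (-(b * heavyLevel b A n ^ 2 / n)) = (n : ℝ) ^ (-A) := by
  have hn0 : (0 : ℝ) < n := by exact_mod_cast hn
  rw [sq_heavyLevel hb hA hl, Real.rpow_def_of_pos hn0]
  congr 1
  field_simp

theorem natCast_mul_tail_heavyLevel {a b A α : ℝ} {n : ℕ} (hb : 0 < b) (hA : 0 < A) (hn : 0 < n)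
    (hl : 0 < Real.log n) :
    n * (a * heavyLevel b A n ^ (-α)) = a * b ^ (α / 2) * A ^ (-(α / 2)) * cliqueScale α n := by
  have hn0 : (0 : ℝ) < n := by exact_mod_cast hn
  rw [heavyLevel, Real.sqrt_eq_rpow, ← Real.rpow_mul (by positivity),
    show 1 / 2 * -α = -(α / 2) by ring, Real.div_rpow (by positivity) hb.le,
    Real.mul_rpow (by positivity) hl.le, Real.mul_rpow hA.le hn0.le, cliqueScale,
    show 1 - α / 2 = 1 + -(α / 2) by ring, Real.rpow_add hn0, Real.rpow_one,
    Real.rpow_neg hb.le]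
  field_simp

section
variable {μ : Measure ℝ} [IsProbabilityMeasure μ] {a b α x₀ : ℝ}

/-- Each edge between light vertices has at most the probability attained when both weights equal
`L`. No moments enter, because the levels here exceed the order `√n` at which the linear bound is
useful. -/
theorem real_lightEdges_le_pow (hb : 0 ≤ b) {n : ℕ} (L : ℝ) {S : Finset (Fin n)}
    {E : Finset (Pairs n)} (hE : E ⊆ pairsIn S) :
    (seedMeasure μ n).real (lightEdges b n L S E) ≤
      (1 - Real.exp (-(b * L ^ 2 / n))) ^ E.card := by
  have h := seedMeasure_real_weights_inter_edges μ (n := n) b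
    (measurableSet_forall_mem S (measurableSet_abs_le L)) E
  have hρ : 0 ≤ 1 - Real.exp (-(b * L ^ 2 / n)) := by
    rw [sub_nonneg, Real.exp_le_one_iff, neg_nonpos]; positivity
  refine h.le.trans ((integral_mono_of_nonneg (g := fun _ ↦
    (1 - Real.exp (-(b * L ^ 2 / n))) ^ E.card) (.of_forall fun w ↦ ?_) (integrable_const _)
    (.of_forall fun w ↦ ?_)).trans (le_of_eq (by simp)))
  · exact mul_nonneg (Set.indicator_nonneg (by simp) _)
      (Finset.prod_nonneg fun e _ ↦ (edgeProb _ _ _ _).2.1)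
  · by_cases hw : ∀ i ∈ S, w i ∈ {x | |x| ≤ L}
    · simp only
      rw [Set.indicator_of_mem (by exact hw), Pi.one_apply, one_mul, ← Finset.prod_const]
      refine Finset.prod_le_prod (fun e _ ↦ (edgeProb _ _ _ _).2.1) fun e he ↦ ?_
      have he' := mem_pairsIn.1 (hE he)
      have h1 : |w e.1.1| ≤ L := hw _ he'.1
      have h2 : |w e.1.2| ≤ L := hw _ he'.2
      refine edgeProb_le_one_sub_exp hb n ?_ (sq_nonneg L)
      calc w e.1.1 * w e.1.2 ≤ |w e.1.1| * |w e.1.2| := by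
            rw [← abs_mul]; exact le_abs_self _
        _ ≤ L ^ 2 := by
            rw [sq]; exact mul_le_mul h1 h2 (abs_nonneg _) ((abs_nonneg _).trans h1)
    · simp only
      rw [Set.indicator_of_notMem (by exact hw), zero_mul]
      positivity

/-- First moment: a light pair is missing with probability at least `n⁻ᴬ`, so the expected number of
light `k`-cliques is at most `exp (k log n - n⁻ᴬ k (k - 1) / 2)`. -/
theorem tendsto_real_large_lightClique (hb : 0 < b) {A : ℝ} (hA : 0 < A) :
    Tendsto (fun n : ℕ ↦ (seedMeasure μ n).real {ω | ∃ S : Finset (Fin n),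
      S.card = ⌈4 * ((n : ℝ) ^ A * Real.log n)⌉₊ + 2 ∧
        ω ∈ lightEdges b n (heavyLevel b A n) S (pairsIn S)}) atTop (𝓝 0) := by
  refine squeeze_zero' (.of_forall fun n ↦ measureReal_nonneg) ?_
    tendsto_inv_atTop_nhds_zero_nat
  filter_upwards [eventually_log_natCast_pos, eventually_gt_atTop 0] with n hl hn
  have hn0 : (0 : ℝ) < n := by exact_mod_cast hn
  -- Since `k - 1 ≥ 4 nᴬ log n`, the cost `n⁻ᴬ k (k - 1) / 2` is at least `2 k log n`, twice the
  -- entropy term, which leaves at most `1 / n`.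
  set k := ⌈4 * ((n : ℝ) ^ A * Real.log n)⌉₊ + 2 with hk
  set m := k * (k - 1) / 2 with hm
  set ρ := 1 - Real.exp (-(b * heavyLevel b A n ^ 2 / n)) with hρ
  have hρe : ρ = 1 - (n : ℝ) ^ (-A) := by rw [hρ, exp_heavyLevel hb hA hn hl]
  have hρ0 : 0 ≤ ρ := by
    rw [hρ, sub_nonneg, Real.exp_le_one_iff, neg_nonpos]; positivity
  have hρ1 : ρ ≤ Real.exp (-(n : ℝ) ^ (-A)) := by
    rw [hρe]; exact Real.one_sub_le_exp_neg _
  have hkm : (k : ℝ) * (k - 1) / 2 ≤ (m : ℝ) := by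
    have h2 : 2 * m = k * (k - 1) := Nat.mul_div_cancel' (Nat.even_mul_pred_self k).two_dvd
    have h3 : (2 : ℝ) * m = k * ((k - 1 : ℕ) : ℝ) := by exact_mod_cast h2
    rw [Nat.cast_sub (by omega), Nat.cast_one] at h3
    linarith
  have hk1 : 4 * ((n : ℝ) ^ A * Real.log n) ≤ (k : ℝ) - 1 := by
    have := Nat.le_ceil (4 * ((n : ℝ) ^ A * Real.log n))
    rw [hk]; push_cast; linarith
  refine (real_exists_card_eq_le μ (c := ρ ^ m) (pow_nonneg hρ0 _) fun S hS ↦ ?_).trans ?_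
  · refine (real_lightEdges_le_pow hb.le _ (Finset.Subset.refl _)).trans (le_of_eq ?_)
    have := two_mul_card_pairsIn S
    rw [hS] at this
    congr 1
    omega
  · have hpos : 0 < (n : ℝ) ^ (-A) := Real.rpow_pos_of_pos hn0 _
    have hnA : (n : ℝ) ^ (-A) * (n : ℝ) ^ A = 1 := by
      rw [← Real.rpow_add hn0]; simp
    have h1 : 2 * Real.log n * k ≤ m * (n : ℝ) ^ (-A) := by
      have h2 : 4 * Real.log n ≤ (n : ℝ) ^ (-A) * ((k : ℝ) - 1) := by
        calc 4 * Real.log n = (n : ℝ) ^ (-A) * (4 * ((n : ℝ) ^ A * Real.log n)) := by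
              rw [show (n : ℝ) ^ (-A) * (4 * ((n : ℝ) ^ A * Real.log n)) =
                (n : ℝ) ^ (-A) * (n : ℝ) ^ A * (4 * Real.log n) by ring, hnA, one_mul]
          _ ≤ _ := by gcongr
      calc 2 * Real.log n * k = 4 * Real.log n * k / 2 := by ring
        _ ≤ (n : ℝ) ^ (-A) * ((k : ℝ) - 1) * k / 2 := by gcongr
        _ = (k : ℝ) * (k - 1) / 2 * (n : ℝ) ^ (-A) := by ring
        _ ≤ _ := by gcongr
    have hk2 : (1 : ℝ) ≤ k := by
      have : 1 ≤ k := by omega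
      exact_mod_cast this
    calc (n : ℝ) ^ k * ρ ^ m ≤ Real.exp (k * Real.log n) * Real.exp (m * -(n : ℝ) ^ (-A)) := by
          rw [Real.exp_nat_mul, Real.exp_nat_mul, Real.exp_log hn0]
          gcongr
      _ = Real.exp (k * Real.log n - m * (n : ℝ) ^ (-A)) := by rw [← Real.exp_add]; ring_nf
      _ ≤ Real.exp (-Real.log n) := by
          gcongr
          nlinarith
      _ = (n : ℝ)⁻¹ := by rw [Real.exp_neg, Real.exp_log hn0]

theorem tendsto_real_cliqueNum_gt (hμ : ∀ᵐ x ∂μ, 0 ≤ x) (hb : 0 < b) (hα : α < 2)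
    (htail : ∀ x : ℝ, x₀ ≤ x → μ.real (Set.Ioi x) = a * x ^ (-α)) {A C : ℝ} (hA0 : 0 < A)
    (hA : A < 1 - α / 2) (hC : a * b ^ (α / 2) * A ^ (-(α / 2)) < C) :
    Tendsto (fun n : ℕ ↦ (seedMeasure μ n).real
      {ω | C < (seedGraph b n ω).cliqueNum / cliqueScale α n}) atTop (𝓝 0) := by
  set c := a * b ^ (α / 2) * A ^ (-(α / 2)) with hc
  -- Half the gap pays for the fluctuation of the number of heavy vertices, and half for the light
  -- clique.
  set d := (C - c) / 2 with hd
  have hd0 : 0 < d := by rw [hd]; linarith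
  have h1 := tendsto_real_large_lightClique (μ := μ) hb hA0
  have h2 : Tendsto (fun n : ℕ ↦ c / d ^ 2 * (cliqueScale α n)⁻¹) atTop (𝓝 0) := by
    simpa using (tendsto_inv_cliqueScale hα).const_mul (c / d ^ 2)
  have h3 : Tendsto (fun n : ℕ ↦ 4 * ((n : ℝ) ^ A * Real.log n / cliqueScale α n) +
      3 * (cliqueScale α n)⁻¹) atTop (𝓝 0) := by
    simpa using ((tendsto_rpow_mul_log_div_cliqueScale hA).const_mul 4).add
      ((tendsto_inv_cliqueScale hα).const_mul 3)
  have h4 := h1.add h2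
  rw [add_zero] at h4
  refine squeeze_zero' (.of_forall fun n ↦ measureReal_nonneg) ?_ h4
  filter_upwards [eventually_log_natCast_pos, eventually_gt_atTop 0,
    (tendsto_heavyLevel hb hA0).eventually_ge_atTop x₀, h3.eventually_lt_const hd0] with
    n hl hn hx h5
  have hr := cliqueScale_pos (α := α) hn hl
  set r := cliqueScale α n with hr'
  have hn0 : (0 : ℝ) < n := by exact_mod_cast hn
  have hq : n * μ.real {x | heavyLevel b A n < |x|} = c * r := by
    rw [real_lt_abs hμ htail hx, natCast_mul_tail_heavyLevel hb hA0 hn hl]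
  have h6 := (real_card_vertsIn_ge_le (μ := μ) (n := n) (measurableSet_lt_abs (heavyLevel b A n))
    (mul_pos hd0 hr)).trans_eq (congrArg (· / (d * r) ^ 2) hq)
  have h7 : c * r / (d * r) ^ 2 = c / d ^ 2 * r⁻¹ := by field_simp
  refine le_trans (measureReal_mono fun ω hω ↦ ?_) ((measureReal_union_le _ _).trans
    (add_le_add le_rfl (h6.trans_eq h7)))
  by_contra hcon
  rw [Set.mem_union, not_or] at hcon
  have h8 := cliqueNum_lt_of_no_lightClique hcon.1
  have h9 : ¬ n * μ.real {x | heavyLevel b A n < |x|} + d * r ≤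
    ((vertsIn {x | heavyLevel b A n < |x|} fun i ↦ ω (.inl i)).card : ℝ) := hcon.2
  rw [hq, not_le] at h9
  have h8' : ((seedGraph b n ω).cliqueNum : ℝ) < (⌈4 * ((n : ℝ) ^ A * Real.log n)⌉₊ + 2 : ℕ) +
    ((vertsIn {x | heavyLevel b A n < |x|} fun i ↦ ω (.inl i)).card : ℝ) := by exact_mod_cast h8
  have h10 : ((⌈4 * ((n : ℝ) ^ A * Real.log n)⌉₊ + 2 : ℕ) : ℝ) ≤
      4 * ((n : ℝ) ^ A * Real.log n) + 3 := by
    have := Nat.ceil_lt_add_one (show 0 ≤ 4 * ((n : ℝ) ^ A * Real.log n) by positivity)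
    push_cast
    linarith
  have h11 : 4 * ((n : ℝ) ^ A * Real.log n) + 3 < d * r := by
    rw [← div_lt_iff₀ hr]
    refine lt_of_eq_of_lt ?_ h5
    field_simp
  have hω : C < (seedGraph b n ω).cliqueNum / r := hω
  rw [lt_div_iff₀ hr] at hω
  have h12 : C * r = c * r + d * r + d * r := by rw [hd]; ring
  linarith

open Classical in
/-- The non-adjacent pairs of vertices of weight above `t`. -/
noncomputable def missingPairs (b : ℝ) (n : ℕ) (t : ℝ) (ω : Fin n ⊕ Pairs n → ℝ) :
    Finset (Pairs n) :=
  Finset.univ.filter fun e ↦ t < ω (.inl e.1.1) ∧ t < ω (.inl e.1.2) ∧ ¬ SeedEdge b n ω e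

/-- Deleting the first endpoint of every missing pair from the heavy vertices leaves a clique. -/
theorem card_vertsIn_le_cliqueNum_add (b : ℝ) (n : ℕ) (t : ℝ) (ω : Fin n ⊕ Pairs n → ℝ) :
    (vertsIn (Set.Ioi t) fun i ↦ ω (.inl i)).card ≤
      (seedGraph b n ω).cliqueNum + (missingPairs b n t ω).card := by
  set H := vertsIn (Set.Ioi t) fun i ↦ ω (.inl i) with hH
  set F := missingPairs b n t ω with hF
  have hS : (seedGraph b n ω).IsClique (H \ F.image fun e ↦ e.1.1 : Finset (Fin n)) := by
    refine seedGraph_isClique.2 fun e he ↦ ?_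
    rw [mem_pairsIn, Finset.mem_sdiff, Finset.mem_sdiff] at he
    by_contra hne
    refine he.1.2 (Finset.mem_image.2 ⟨e, ?_, rfl⟩)
    have h1 : t < ω (.inl e.1.1) := mem_vertsIn.1 he.1.1
    have h2 : t < ω (.inl e.1.2) := mem_vertsIn.1 he.2.1
    simp [hF, missingPairs, h1, h2, hne]
  have h1 := hS.card_le_cliqueNum
  have h2 := Finset.le_card_sdiff (F.image fun e ↦ e.1.1) H
  have h3 : (F.image fun e ↦ e.1.1).card ≤ F.card := Finset.card_image_le
  omega

theorem real_missing_le (hb : 0 ≤ b) {n : ℕ} {t : ℝ} (ht : 0 ≤ t) (e : Pairs n) :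
    (seedMeasure μ n).real {ω | t < ω (.inl e.1.1) ∧ t < ω (.inl e.1.2) ∧ ¬ SeedEdge b n ω e} ≤
      Real.exp (-(b * t ^ 2 / n)) * μ.real (Set.Ioi t) ^ 2 := by
  have hm : MeasurableSet {ω : Fin n ⊕ Pairs n → ℝ |
      t < ω (.inl e.1.1) ∧ t < ω (.inl e.1.2) ∧ ¬ SeedEdge b n ω e} :=
    (measurableSet_lt measurable_const (measurable_pi_apply _)).inter
      ((measurableSet_lt measurable_const (measurable_pi_apply _)).inter
        (measurableSet_seedEdge b n e).compl)
  have hB := measurableSet_forall_mem ({e.1.1, e.1.2} : Finset (Fin n))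
    (measurableSet_Ioi (a := t))
  have hBq := pi_real_forall_mem μ ({e.1.1, e.1.2} : Finset (Fin n)) fun _ ↦ Set.Ioi t
  rw [Finset.prod_const, Finset.card_pair e.2.ne] at hBq
  rw [seedMeasure_real_eq_integral μ hm, ← hBq, ← integral_indicator_one hB, ← integral_const_mul]
  refine integral_mono_of_nonneg (.of_forall fun _ ↦ measureReal_nonneg)
    (((integrable_const 1).indicator hB).const_mul _) (.of_forall fun w ↦ ?_)
  by_cases hw : t < w e.1.1 ∧ t < w e.1.2
  · have hw' : w ∈ {w : Fin n → ℝ | ∀ i ∈ ({e.1.1, e.1.2} : Finset (Fin n)), w i ∈ Set.Ioi t} := by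
      simpa using hw
    simp only
    rw [Set.indicator_of_mem hw', Pi.one_apply, mul_one]
    have h1 := real_forall_edgeProb_le n b w {e}
    rw [Finset.prod_singleton] at h1
    have h2 := one_sub_exp_le_edgeProb hb n (x := w e.1.1) (y := w e.1.2) (t := t ^ 2)
      (by nlinarith [hw.1, hw.2]) (by positivity)
    refine le_trans (measureReal_mono fun u hu ↦ ?_) (h1.le.trans (by linarith))
    intro e' he'
    rw [Finset.mem_singleton.1 he']
    exact not_lt.1 hu.2.2
  · have : {u : Pairs n → ℝ | Sum.elim w u ∈ {ω : Fin n ⊕ Pairs n → ℝ |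
        t < ω (.inl e.1.1) ∧ t < ω (.inl e.1.2) ∧ ¬ SeedEdge b n ω e}} = ∅ := by
      ext u
      simp only [Set.mem_ofPred_eq, Sum.elim_inl, Set.mem_empty_iff_false, iff_false]
      exact fun h ↦ hw ⟨h.1, h.2.1⟩
    simp only
    rw [this, measureReal_empty]
    exact mul_nonneg (Real.exp_pos _).le (Set.indicator_nonneg (by simp) _)

theorem real_card_missingPairs_ge_le (hb : 0 ≤ b) {n : ℕ} {t s : ℝ} (ht : 0 ≤ t) (hs : 0 < s) :
    (seedMeasure μ n).real {ω | s ≤ ((missingPairs b n t ω).card : ℝ)} ≤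
      Real.exp (-(b * t ^ 2 / n)) * (n * μ.real (Set.Ioi t)) ^ 2 / s := by
  classical
  set bad : Pairs n → Set (Fin n ⊕ Pairs n → ℝ) := fun e ↦
    {ω | t < ω (.inl e.1.1) ∧ t < ω (.inl e.1.2) ∧ ¬ SeedEdge b n ω e} with hbad
  have hm : ∀ e, MeasurableSet (bad e) := fun e ↦
    (measurableSet_lt measurable_const (measurable_pi_apply _)).inter
      ((measurableSet_lt measurable_const (measurable_pi_apply _)).inter
        (measurableSet_seedEdge b n e).compl)
  have hcard : ∀ ω, ((missingPairs b n t ω).card : ℝ) = ∑ e, (bad e).indicator 1 ω := fun ω ↦ by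
    simp [missingPairs, Set.indicator_apply, hbad]
  have hI : ∀ e, Integrable ((bad e).indicator (1 : (Fin n ⊕ Pairs n → ℝ) → ℝ))
      (seedMeasure μ n) := fun e ↦
    (integrable_const 1).indicator (hm e)
  have h1 := mul_meas_ge_le_integral_of_nonneg (μ := seedMeasure μ n)
    (f := fun ω ↦ ((missingPairs b n t ω).card : ℝ)) (.of_forall fun ω ↦ Nat.cast_nonneg _)
    (by simp_rw [hcard]; exact integrable_finsetSum _ fun e _ ↦ hI e) s
  have h2 : ∫ ω, ((missingPairs b n t ω).card : ℝ) ∂seedMeasure μ n ≤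
      Real.exp (-(b * t ^ 2 / n)) * (n * μ.real (Set.Ioi t)) ^ 2 := by
    simp_rw [hcard]
    rw [integral_finsetSum _ fun e _ ↦ hI e]
    simp_rw [integral_indicator_one (hm _)]
    refine (Finset.sum_le_card_nsmul _ _ _ fun e _ ↦ real_missing_le hb ht e).trans ?_
    have hP : (Finset.univ : Finset (Pairs n)).card ≤ n ^ 2 := by
      rw [Finset.card_univ]
      refine (Fintype.card_subtype_le _).trans (le_of_eq ?_)
      simp [sq]
    have hP' : ((Finset.univ : Finset (Pairs n)).card : ℝ) ≤ (n : ℝ) ^ 2 := by exact_mod_cast hP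
    rw [nsmul_eq_mul]
    calc _ ≤ (n : ℝ) ^ 2 * (Real.exp (-(b * t ^ 2 / n)) * μ.real (Set.Ioi t) ^ 2) := by gcongr
      _ = _ := by ring
  rw [le_div_iff₀ hs, mul_comm]
  exact h1.trans h2

/-- With `r` the scale, there are about `c r` heavy vertices and on average at most `n⁻ᴬ (c r)²`
missing pairs among them. The latter is `o(r)` because `r n⁻ᴬ → 0` for `A > 1 - α / 2`. -/
theorem tendsto_real_cliqueNum_lt (hb : 0 < b) (hα : α < 2)
    (htail : ∀ x : ℝ, x₀ ≤ x → μ.real (Set.Ioi x) = a * x ^ (-α)) {A C : ℝ} (hA0 : 0 < A)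
    (hA : 1 - α / 2 < A) (hC : C < a * b ^ (α / 2) * A ^ (-(α / 2))) :
    Tendsto (fun n : ℕ ↦ (seedMeasure μ n).real
      {ω | (seedGraph b n ω).cliqueNum / cliqueScale α n < C}) atTop (𝓝 0) := by
  set c := a * b ^ (α / 2) * A ^ (-(α / 2)) with hc
  set d := (c - C) / 2 with hd
  have hd0 : 0 < d := by rw [hd]; linarith
  have h2 : Tendsto (fun n : ℕ ↦ c / d ^ 2 * (cliqueScale α n)⁻¹) atTop (𝓝 0) := by
    simpa using (tendsto_inv_cliqueScale hα).const_mul (c / d ^ 2)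
  have h3 : Tendsto (fun n : ℕ ↦ c ^ 2 / d * (cliqueScale α n * (n : ℝ) ^ (-A))) atTop (𝓝 0) := by
    simpa using (tendsto_cliqueScale_mul_rpow_neg hA).const_mul (c ^ 2 / d)
  have h4 := h2.add h3
  rw [add_zero] at h4
  refine squeeze_zero' (.of_forall fun n ↦ measureReal_nonneg) ?_ h4
  filter_upwards [eventually_log_natCast_pos, eventually_gt_atTop 0,
    (tendsto_heavyLevel hb hA0).eventually_ge_atTop x₀] with n hl hn hx
  have hr := cliqueScale_pos (α := α) hn hl
  set r := cliqueScale α n with hr'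
  set t := heavyLevel b A n with ht
  have hq : n * μ.real (Set.Ioi t) = c * r := by
    rw [htail _ hx, natCast_mul_tail_heavyLevel hb hA0 hn hl]
  have hm : MeasurableSet {w : Fin n → ℝ |
      ((vertsIn (Set.Ioi t) w).card : ℝ) ≤ n * μ.real (Set.Ioi t) - d * r} :=
    measurableSet_le (measurable_card_vertsIn measurableSet_Ioi) measurable_const
  have h6 := (seedMeasure_real_weights μ hm).le.trans ((real_card_vertsIn_le_le (μ := μ) (n := n)
    (measurableSet_Ioi (a := t)) (mul_pos hd0 hr)).trans_eq (congrArg (· / (d * r) ^ 2) hq))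
  have h7 : c * r / (d * r) ^ 2 = c / d ^ 2 * r⁻¹ := by field_simp
  have h8 := real_card_missingPairs_ge_le (μ := μ) hb.le (n := n) (t := t) (Real.sqrt_nonneg _)
    (mul_pos hd0 hr)
  rw [hq, exp_heavyLevel hb hA0 hn hl] at h8
  have h9 : (n : ℝ) ^ (-A) * (c * r) ^ 2 / (d * r) = c ^ 2 / d * (r * (n : ℝ) ^ (-A)) := by
    field_simp
  refine le_trans (measureReal_mono fun ω hω ↦ ?_) ((measureReal_union_le _ _).trans
    (add_le_add (h6.trans_eq h7) (h8.trans_eq h9)))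
  by_contra hcon
  rw [Set.mem_union, not_or] at hcon
  have h10 : ¬ ((vertsIn (Set.Ioi t) fun i ↦ ω (.inl i)).card : ℝ) ≤
    n * μ.real (Set.Ioi t) - d * r := hcon.1
  have h11 : ¬ d * r ≤ ((missingPairs b n t ω).card : ℝ) := hcon.2
  rw [hq, not_le] at h10
  have h12 : ((vertsIn (Set.Ioi t) fun i ↦ ω (.inl i)).card : ℝ) ≤
      (seedGraph b n ω).cliqueNum + (missingPairs b n t ω).card := by
    exact_mod_cast card_vertsIn_le_cliqueNum_add b n t ω
  have hω : (seedGraph b n ω).cliqueNum / r < C := hω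
  rw [div_lt_iff₀ hr] at hω
  have h13 : C * r = c * r - d * r - d * r := by rw [hd]; ring
  linarith

theorem isLittleOpOne_cliqueNum (hμ : ∀ᵐ x ∂μ, 0 ≤ x) (hb : 0 < b) (hα : α < 2)
    (htail : ∀ x : ℝ, x₀ ≤ x → μ.real (Set.Ioi x) = a * x ^ (-α)) :
    IsLittleOpOne (graphLaw μ b) (fun n G ↦ (G.cliqueNum : ℝ) / cliqueScale α n -
      a * b ^ (α / 2) * (1 - α / 2) ^ (-(α / 2))) := by
  intro ε hε
  set c := a * b ^ (α / 2) * (1 - α / 2) ^ (-(α / 2)) with hc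
  have hβ : 0 < 1 - α / 2 := by linarith
  have hcont : ContinuousAt (fun A : ℝ ↦ a * b ^ (α / 2) * A ^ (-(α / 2))) (1 - α / 2) :=
    (Real.continuousAt_rpow_const _ _ (.inl hβ.ne')).const_mul _
  -- The upper and lower bounds need `A` strictly on opposite sides of `1 - α / 2`; continuity in
  -- `A` brings both constants within `ε` of `c`.
  obtain ⟨A₁, ⟨h1, h1'⟩, h1''⟩ : ∃ A : ℝ, (a * b ^ (α / 2) * A ^ (-(α / 2)) < c + ε ∧ 0 < A) ∧
      A < 1 - α / 2 :=
    ((((hcont.eventually_lt_const (by linarith)).and (eventually_gt_nhds hβ)).filter_mono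
      nhdsWithin_le_nhds).and (self_mem_nhdsWithin (s := Set.Iio (1 - α / 2)))).exists
  obtain ⟨A₂, h2, h2'⟩ : ∃ A : ℝ, c - ε < a * b ^ (α / 2) * A ^ (-(α / 2)) ∧ 1 - α / 2 < A :=
    (((hcont.eventually_const_lt (by linarith)).filter_mono
      nhdsWithin_le_nhds).and (self_mem_nhdsWithin (s := Set.Ioi (1 - α / 2)))).exists
  have hlim := (tendsto_real_cliqueNum_gt hμ hb hα htail h1' h1'' h1).add
    (tendsto_real_cliqueNum_lt hb hα htail (hβ.trans h2') h2' h2)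
  rw [add_zero] at hlim
  refine squeeze_zero (fun n ↦ measureReal_nonneg) (fun n ↦ ?_) hlim
  rw [graphLaw_real]
  refine (measureReal_mono fun ω hω ↦ ?_).trans (measureReal_union_le _ _)
  have hω : ε < |((seedGraph b n ω).cliqueNum : ℝ) / cliqueScale α n - c| := hω
  rcases lt_abs.1 hω with h | h
  · exact .inl (show c + ε < ((seedGraph b n ω).cliqueNum : ℝ) / cliqueScale α n by linarith)
  · exact .inr (show ((seedGraph b n ω).cliqueNum : ℝ) / cliqueScale α n < c - ε by linarith)

end

end PoissonianGraph

theorem theorem1 (μ : Measure ℝ) [IsProbabilityMeasure μ] (hμ : ∀ᵐ x ∂μ, 0 ≤ x)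
    (a b α x₀ : ℝ) (ha : 0 < a) (hb : 0 < b) (hα : 0 < α) (hx₀ : 0 < x₀)
    (htail : ∀ x : ℝ, x₀ ≤ x → μ.real (Set.Ioi x) = a * x ^ (-α)) :
    (α < 2 →
      IsLittleOpOne (graphLaw μ b) (fun n G ↦
        (G.cliqueNum : ℝ) / ((n : ℝ) ^ (1 - α / 2) * Real.log n ^ (-(α / 2)))
          - a * b ^ (α / 2) * (1 - α / 2) ^ (-(α / 2)))) ∧
    (α = 2 →
      IsBigOpOne (graphLaw μ b) (fun _ G ↦ (G.cliqueNum : ℝ)) ∧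
      ¬ ∃ C : ℝ, Whp (graphLaw μ b) (fun _ ↦ {G | (G.cliqueNum : ℝ) ≤ C})) ∧
    (2 < α →
      Whp (graphLaw μ b) (fun _ ↦ {G | G.cliqueNum = 2 ∨ G.cliqueNum = 3}) ∧
      Integrable (fun x ↦ x ^ 2) μ ∧
      Tendsto (fun n ↦ (graphLaw μ b n).real {G | G.cliqueNum = 2}) atTop
        (𝓝 (Real.exp (-(1 / 6 * (b * ∫ x, x ^ 2 ∂μ) ^ 3)))) ∧
      Tendsto (fun n ↦ (graphLaw μ b n).real {G | G.cliqueNum = 3}) atTop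
        (𝓝 (1 - Real.exp (-(1 / 6 * (b * ∫ x, x ^ 2 ∂μ) ^ 3)))) ∧
      0 < Real.exp (-(1 / 6 * (b * ∫ x, x ^ 2 ∂μ) ^ 3)) ∧
      0 < 1 - Real.exp (-(1 / 6 * (b * ∫ x, x ^ 2 ∂μ) ^ 3))) := by
  refine ⟨fun h ↦ ?_, ?_, fun h ↦ ?_⟩
  · exact isLittleOpOne_cliqueNum hμ hb h htail
  · rintro rfl
    exact ⟨isBigOpOne_cliqueNum hμ ha hb hx₀ htail, not_whp_cliqueNum_le ha hb hx₀ htail⟩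
  · have hint := integrable_sq_of_tail hμ ha.le h hx₀ htail
    have hpos := integral_sq_pos ha hx₀ htail hint
    refine ⟨whp_cliqueNum_two_or_three hμ ha hb h hx₀ htail, hint,
      tendsto_real_cliqueNum_eq_two hμ ha hb h hx₀ htail,
      tendsto_real_cliqueNum_eq_three hμ ha hb h hx₀ htail, Real.exp_pos _, ?_⟩
    rw [sub_pos, Real.exp_lt_one_iff, neg_lt_zero]
    positivity
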